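/- Let $\mathfrak o$ be a compact discrete valuation ring (of arbitrary characteristic), with maximal ideal $\mathfrak p$ and residue field of cardinality $q$, and let $n\ge 1$. For $N\ge 0$ put $\mathfrak o_N=\mathfrak o/\mathfrak p^N$ and let $\mathfrak{sl}_n(\mathfrak o_N)$ be the set of $n\times n$-matrices of trace zero over $\mathfrak o_N$. Put $\mathfrak{sl}_n(\mathfrak o_0)^*=\{0\}$ and $\mathfrak{sl}_n(\mathfrak o_N)^*=\mathfrak{sl}_n(\mathfrak o_N)\setminus \mathfrak p\,\mathfrak{sl}_n(\mathfrak o_N)$ for $N\ge1$, and write $\operatorname{im}(\boldsymbol x)$ for the image of $\boldsymbol x$ acting on $\mathfrak o_N^n$. Write $t=q^{-s}$, and define the image zeta function of $\mathfrak{sl}_n(\mathfrak o)$ as the formal power series $$\mathcal P_{n,\mathfrak o}(s)=\sum_{N=0}^\infty\ \sum_{\boldsymbol x\in\mathfrak{sl}_n(\mathfrak o_N)^*}|\operatorname{im}(\boldsymbol x)|^{-s}\in\mathbb Q[[t]],$$ that is, the coefficient of $t^k$ is the number of pairs $(N,\boldsymbol x)$ with $\boldsymbol x\in\mathfrak{sl}_n(\mathfrak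 o_N)^*$ and $|\operatorname{im}(\boldsymbol x)|=q^k$. For $i\le n$ and a finite set $I=\{i_1<\dots<i_\ell\}\subseteq\{0,\dots,n-1\}$ put $$\binom{n}{i}_X=\prod_{j=1}^i\frac{1-X^{n-i+j}}{1-X^j},\qquad \binom{n}{I}_X=\binom{n}{i_\ell}_X\binom{i_\ell}{i_{\ell-1}}_X\cdots\binom{i_2}{i_1}_X,$$ $$f_{n,I}(X)=\binom nI_X\prod_{j=\min I+1}^n(1-X^j)\quad(\text{with } f_{n,\varnothing}=1),$$ and, for $0\le i\le n-1$, $$b_{n,i}(X)=f_{n,\{i\}}(X)+(-1)^{n-i}\binom ni_X(1-X)X^{\binom{n+1}2-\binom{i+1}2-1}.$$ Write $\operatorname{gp}(X)=\frac{X}{1-X}$ and $x_{n,i}=q^{n^2-i^2-1}t^{n-i}$. Then $\mathcal P_{n,\mathfrak o}(s)$ is well defined: for every $N$ and every $\boldsymbol x\in\mathfrak{sl}_n(\mathfrak o_N)^*$ the number $|\operatorname{im}(\boldsymbol x)|$ is a power of $q$, and for every $k$ only finitely many pairs $(N,\boldsymbol x)$ satisfy $|\operatorname{im}(\boldsymbol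 x)|=q^k$. Moreover, in $\mathbb Q[[t]]$, $$\mathcal P_{n,\mathfrak o}(s)=1+\sum_{i=0}^{n-1}b_{n,i}(q^{-1})\operatorname{gp}(x_{n,i})\sum_{J\subseteq\{0,\dots,i-1\}}f_{i,J}(q^{-1})\prod_{j\in J}\operatorname{gp}(x_{n,j}).$$ -/

import Mathlib

open PowerSeries

noncomputable section

namespace ImageZeta

section Polynomials

variable {K : Type*} [Field K]

/-- The `X`-binomial coefficient `∏_{j=1}^{i} (1 - X^(n-i+j)) / (1 - X^j)`, for `i ≤ n`, evaluated
at an element `X` of a field which is not a root of any `1 - X^j` with `1 ≤ j ≤ i`. -/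
def qBinom (n i : ℕ) (X : K) : K :=
  ∏ j ∈ Finset.Icc 1 i, (1 - X ^ (n - i + j)) / (1 - X ^ j)

/-- `binom(n, i_ℓ) * binom(i_ℓ, i_{ℓ-1}) * ... * binom(i_2, i_1)` for a decreasing list
`[i_ℓ, ..., i_1]`; it is `1` for the empty list. -/
def qMultinomList (X : K) : ℕ → List ℕ → K
  | _, [] => 1
  | n, i :: l => qBinom n i X * qMultinomList X i l

/-- The `X`-multinomial coefficient `binom(n, I)_X`. -/
def qMultinom (n : ℕ) (I : Finset ℕ) (X : K) : K :=
  qMultinomList X n (I.sort (· ≥ ·))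

/-- `f_{n,I}(X) = binom(n, I)_X * ∏_{j = min I + 1}^{n} (1 - X^j)`.
For `I = ∅` the product is empty, so `f_{n,∅} = 1`. -/
def f (n : ℕ) (I : Finset ℕ) (X : K) : K :=
  qMultinom n I X * ∏ j ∈ Finset.Ioc (I.min.untopD n) n, (1 - X ^ j)

/-- `b_{n,i}(X) = f_{n,{i}}(X)
  + (-1)^(n-i) binom(n, i)_X (1 - X) X^(binom(n+1,2) - binom(i+1,2) - 1)`, for `i < n`. -/
def b (n i : ℕ) (X : K) : K :=
  f n {i} X + (-1) ^ (n - i) * qBinom n i X * (1 - X) *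
    X ^ ((n + 1).choose 2 - (i + 1).choose 2 - 1)

end Polynomials

section FormalSeries

/-- `gp(x) = x / (1 - x)` for a formal power series `x` with zero constant term. -/
def gp (x : ℚ⟦X⟧) : ℚ⟦X⟧ := x * (1 - x)⁻¹

/-- `x_{n,i} = q^(n² - i² - 1) t^(n-i)` for `i < n`, with `t` the power series variable. -/
def x (q n i : ℕ) : ℚ⟦X⟧ :=
  C ((q : ℚ) ^ (n ^ 2 - i ^ 2 - 1)) * X ^ (n - i)

end FormalSeries

section Matrices

variable (𝔬 : Type*) [CommRing 𝔬] [IsLocalRing 𝔬]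

/-- `𝔬_N = 𝔬 / 𝔭^N`. -/
abbrev Level (N : ℕ) : Type _ := 𝔬 ⧸ (IsLocalRing.maximalIdeal 𝔬 ^ N)

/-- The residue field cardinality `q`. -/
def residueCard : ℕ := Nat.card (IsLocalRing.ResidueField 𝔬)

/-- The `𝔬`-module `sl_n(𝔬_N)` of traceless matrices of level `N`. -/
def sl (n N : ℕ) : Submodule 𝔬 (Matrix (Fin n) (Fin n) (Level 𝔬 N)) :=
  LinearMap.ker (Matrix.traceLinearMap (Fin n) 𝔬 (Level 𝔬 N))

/-- The set `sl_n(𝔬_N)^*` of primitive traceless matrices: it is `sl_n(𝔬_N) \ 𝔭 sl_n(𝔬_N)`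
for `N ≥ 1`, and `{0}` for `N = 0`. -/
def primitive (n : ℕ) : (N : ℕ) → Set (Matrix (Fin n) (Fin n) (Level 𝔬 N))
  | 0 => {0}
  | N + 1 => (sl 𝔬 n (N + 1) : Set _) \
      ((IsLocalRing.maximalIdeal 𝔬 • sl 𝔬 n (N + 1) : Submodule 𝔬 _) : Set _)

variable {𝔬} in
/-- The size of the image of `A`, viewed as an endomorphism of `𝔬_N^n`. -/
def imageCard {n N : ℕ} (A : Matrix (Fin n) (Fin n) (Level 𝔬 N)) : ℕ :=
  Nat.card (LinearMap.range A.mulVecLin)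

/-- The pairs `(N, A)` with `A` a primitive traceless matrix of level `N` whose image has
size `q^k`, i.e. those with `|im A|^(-s) = t^k`, where `t = q^(-s)`. -/
def pairs (n k : ℕ) : Set (Σ N : ℕ, Matrix (Fin n) (Fin n) (Level 𝔬 N)) :=
  {p | p.2 ∈ primitive 𝔬 n p.1 ∧ imageCard p.2 = residueCard 𝔬 ^ k}

/-- The image zeta function `∑_N ∑_{A ∈ sl_n(𝔬_N)^*} |im A|^(-s)` as a formal power series in
`t = q^(-s)`. -/
def imageZeta (n : ℕ) : ℚ⟦X⟧ :=
  PowerSeries.mk fun k => ((pairs 𝔬 n k).ncard : ℚ)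

end Matrices

end ImageZeta

end

/-!
# The image zeta function of `sl_n` over a compact discrete valuation ring

Let `k` be the residue field, `q` its cardinality, and group the matrices of level `M + 1` by their
reductions over `k`. A reduction of rank `n - i` can be brought into the block form `(1 0; 0 0)` by
invertible matrices. The upper left block of a lift of this normal form is invertible, and eliminating
with it leaves the Schur complement, an `i × i`-matrix with entries in `𝔭 / 𝔭^(M+1) ≅ 𝔬_M`, which
determines the size of the image; each Schur complement arises from `|𝔬_M|^(n² - i²)` lifts. So the
sizes of the images of the lifts depend only on the rank, and are given by the `i × i`-matrices of
level `M` (`SmallExtension.sum_lifts_rangeCard`).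

Among the lifts of a nonzero traceless matrix, the trace is equidistributed over `𝔭 / 𝔭^(M+1)`,
independently of the size of the image: if the `(i, j)`-entry of the reduction is nonzero, then
`A ↦ (1 + s E_{ji}) A`, with `s` in the maximal ideal, preserves the size of the image, and exactly
one `s` makes the trace zero (`SmallExtension.card_mul_sum_traceless_lifts`).

What remains over `k` is to count (traceless) matrices of given rank. Deleting a row gives
recursions, of the type of Pascal's for Gaussian binomial coefficients, both for the number of
matrices of rank `r` (`card_rank_eq`) and for the sum of a nontrivial additive character of the trace
over them (`sum_character_trace`); Fourier inversion then counts the traceless ones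
(`card_rank_eq_trace_zero`). These numbers are `q^(n² - i²) f_{n,{i}}(q⁻¹)` and
`q^(n² - i² - 1) b_{n,i}(q⁻¹)` for `r = n - i` (`pow_sq_sub_sq_mul_f`, `pow_sq_sub_sq_mul_b`).

Writing `Z_i(M)` for the sum of `|im A|^(-s)` over all `i × i`-matrices of level `M`, the series
`S_i = ∑_M x_{n,i}^M Z_i(M)` thus satisfy `S_i = 1 + ∑_{j ≤ i} f_{i,{j}} x_{n,j} S_j`, and the image
zeta function is `1 + ∑_{i < n} b_{n,i} x_{n,i} S_i`. Solving the recursion for the `S_i` and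
expanding by the multiplicativity of `f` along the largest element of a set (`f_insert`) gives the
sum over all subsets (`tsum_x_pow_mul`).
-/

noncomputable section

namespace ImageZeta

/-! ### Ranks of tuples of vectors over a finite field -/

section Rank

variable {F : Type*} [Field F]

/-- The dimension of the span of a tuple of vectors. -/
def tupleRank {m n : ℕ} (a : Fin m → Fin n → F) : ℕ :=
  Module.finrank F (Submodule.span F (Set.range a))

theorem tupleRank_eq_rank {m n : ℕ} (A : Matrix (Fin m) (Fin n) F) : tupleRank A = A.rank := by
  rw [Matrix.rank_eq_finrank_span_row]; rfl

open scoped Classical in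
theorem tupleRank_cons {m n : ℕ} (v : Fin n → F) (a : Fin m → Fin n → F) :
    tupleRank (Fin.cons v a : Fin (m + 1) → Fin n → F) =
      if v ∈ Submodule.span F (Set.range a) then tupleRank a else tupleRank a + 1 := by
  unfold tupleRank
  rw [Fin.range_cons, Submodule.span_insert, sup_comm]
  split_ifs with h
  · rw [sup_eq_left.2 ((Submodule.span_singleton_le_iff_mem _ _).2 h)]
  · exact Submodule.finrank_sup_span_singleton h

/-- Prepending a zero coordinate to all vectors does not change the rank. -/
theorem tupleRank_comp_cons_zero {m n : ℕ} (c : Fin m → Fin n → F) :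
    tupleRank (fun j => (Fin.cons 0 (c j) : Fin (n + 1) → F)) = tupleRank c := by
  let φ : (Fin n → F) →ₗ[F] (Fin (n + 1) → F) :=
    LinearMap.pi (Fin.cons 0 (fun i => LinearMap.proj i))
  have hφ : ∀ v, φ v = Fin.cons 0 v := by
    intro v; ext i; refine Fin.cases ?_ (fun i => ?_) i <;> simp [φ]
  have hinj : Function.Injective φ := by
    intro v w h
    rw [hφ, hφ] at h
    exact (Fin.cons_injective2 h).2
  unfold tupleRank
  rw [show (fun j => (Fin.cons 0 (c j) : Fin (n + 1) → F)) = φ ∘ c from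
    funext fun j => (hφ _).symm, Set.range_comp, Submodule.span_image,
    ← (Submodule.equivMapOfInjective φ hinj _).finrank_eq]

theorem tupleRank_eq_zero_iff {m n : ℕ} (a : Fin m → Fin n → F) : tupleRank a = 0 ↔ a = 0 := by
  rw [tupleRank, Submodule.finrank_eq_zero, Submodule.span_eq_bot]
  exact ⟨fun h => funext fun j => h _ ⟨j, rfl⟩, by rintro rfl _ ⟨j, rfl⟩; rfl⟩

theorem rank_eq_zero_iff {m n : ℕ} (A : Matrix (Fin m) (Fin n) F) : A.rank = 0 ↔ A = 0 := by
  rw [← tupleRank_eq_rank]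
  exact tupleRank_eq_zero_iff A

variable [Fintype F]

open scoped Classical in
theorem sum_mem_span {m n : ℕ} (a : Fin m → Fin n → F) :
    (∑ v : Fin n → F, if v ∈ Submodule.span F (Set.range a) then (1 : ℂ) else 0) =
      (Fintype.card F : ℂ) ^ tupleRank a := by
  rw [Finset.sum_boole, ← Fintype.card_subtype]
  have := Module.card_eq_pow_finrank (K := F) (V := Submodule.span F (Set.range a))
  rw [tupleRank, ← Nat.cast_pow, ← this]

open scoped Classical in
/-- A nontrivial character of the first coordinate sums to zero over a span, unless the first
coordinate vanishes on it. -/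
theorem sum_character_mem_span {m n : ℕ} {ψ : AddChar F ℂ} (hψ : ψ ≠ 1)
    (a : Fin m → Fin (n + 1) → F) :
    (∑ v : Fin (n + 1) → F, if v ∈ Submodule.span F (Set.range a) then ψ (v 0) else 0) =
      if ∀ j, a j 0 = 0 then (Fintype.card F : ℂ) ^ tupleRank a else 0 := by
  split_ifs with h
  · rw [← sum_mem_span]
    refine Finset.sum_congr rfl fun v _ => ?_
    split_ifs with hv
    · have : Submodule.span F (Set.range a) ≤ LinearMap.ker (LinearMap.proj (R := F)
          (φ := fun _ : Fin (n + 1) => F) 0) := by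
        rw [Submodule.span_le]; rintro _ ⟨j, rfl⟩; exact h j
      rw [show v 0 = 0 from this hv, AddChar.map_zero_eq_one]
    · rfl
  · push Not at h
    obtain ⟨j, hj⟩ := h
    obtain ⟨y, hy⟩ := AddChar.ne_one_iff.1 hψ
    -- translation by a vector of the span whose first coordinate is `y`
    set w : Fin (n + 1) → F := (y * (a j 0)⁻¹) • a j with hw
    have hws : w ∈ Submodule.span F (Set.range a) :=
      Submodule.smul_mem _ _ (Submodule.subset_span ⟨j, rfl⟩)
    have hw0 : w 0 = y := by simp [hw, hj]
    set s := ∑ v : Fin (n + 1) → F, if v ∈ Submodule.span F (Set.range a) then ψ (v 0) else 0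
    have key : s = ψ y * s := by
      simp only [s, Finset.mul_sum]
      rw [← Equiv.sum_comp (Equiv.addLeft w)]
      refine Finset.sum_congr rfl fun v _ => ?_
      simp only [Equiv.coe_addLeft, Pi.add_apply, hw0, AddChar.map_add_eq_mul,
        Submodule.add_mem_iff_right _ hws, mul_ite, mul_zero]
    have : (1 - ψ y) * s = 0 := by linear_combination key
    exact (mul_eq_zero.1 this).resolve_left (sub_ne_zero.2 (Ne.symm hy))

open scoped Classical in
/-- Splitting off the first vector of a tuple of prescribed rank. -/
theorem sum_tupleRank_succ {m n r : ℕ} (g : (Fin n → F) → ℂ) (h : (Fin m → Fin n → F) → ℂ) :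
    (∑ a : Fin (m + 1) → Fin n → F,
      if tupleRank a = r + 1 then g (a 0) * h (Fin.tail a) else 0) =
    ∑ a : Fin m → Fin n → F,
      ((if tupleRank a = r + 1 then
          h a * ∑ v, if v ∈ Submodule.span F (Set.range a) then g v else 0 else 0) +
        if tupleRank a = r then
          h a * (∑ v, g v - ∑ v, if v ∈ Submodule.span F (Set.range a) then g v else 0)
          else 0) := by
  rw [← (Fin.consEquiv (fun _ => Fin n → F)).sum_comp, Fintype.sum_prod_type, Finset.sum_comm]
  refine Finset.sum_congr rfl fun a _ => ?_
  have : ∀ v : Fin n → F, (if tupleRank (Fin.consEquiv (fun _ => Fin n → F) (v, a)) = r + 1 then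
      g (Fin.consEquiv (fun _ => Fin n → F) (v, a) 0) *
        h (Fin.tail (Fin.consEquiv (fun _ => Fin n → F) (v, a))) else 0) =
      (if tupleRank a = r + 1 then
        h a * (if v ∈ Submodule.span F (Set.range a) then g v else 0) else 0) +
      (if tupleRank a = r then
        h a * (g v - if v ∈ Submodule.span F (Set.range a) then g v else 0) else 0) := by
    intro v
    have hc : Fin.consEquiv (fun _ => Fin n → F) (v, a) = (Fin.cons v a : Fin (m + 1) → _) := rfl
    simp only [hc, tupleRank_cons, Fin.cons_zero, Fin.tail_cons]
    by_cases hv : v ∈ Submodule.span F (Set.range a)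
    · simp [hv, mul_comm]
    · simp [hv, mul_comm]
  rw [Finset.sum_congr rfl fun v _ => this v, Finset.sum_add_distrib]
  congr 1
  · split_ifs
    · rw [Finset.mul_sum]
    · simp
  · split_ifs
    · rw [← Finset.sum_sub_distrib, Finset.mul_sum]
    · simp

/-- The Gaussian binomial coefficient, as a natural number, by Pascal's recursion. -/
def gaussBinom (q : ℕ) : ℕ → ℕ → ℕ
  | _, 0 => 1
  | 0, _ + 1 => 0
  | n + 1, r + 1 => q ^ (r + 1) * gaussBinom q n (r + 1) + gaussBinom q n r

open scoped Classical in
/-- The number of tuples of prescribed rank. -/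
theorem card_tupleRank (n m r : ℕ) :
    (∑ a : Fin m → Fin n → F, if tupleRank a = r then (1 : ℂ) else 0) =
      gaussBinom (Fintype.card F) m r *
        ∏ j ∈ Finset.range r, ((Fintype.card F : ℂ) ^ n - (Fintype.card F : ℂ) ^ j) := by
  induction m generalizing r with
  | zero =>
    cases r with
    | zero => simp [gaussBinom, tupleRank_eq_zero_iff,
        eq_iff_true_of_subsingleton]
    | succ r =>
      have : ∀ a : Fin 0 → Fin n → F, tupleRank a ≠ r + 1 := fun a => by
        rw [(tupleRank_eq_zero_iff a).2 (Subsingleton.elim _ _)]; omega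
      simp [gaussBinom, this]
  | succ m ih =>
    cases r with
    | zero => simp [gaussBinom, tupleRank_eq_zero_iff]
    | succ r =>
      have := sum_tupleRank_succ (F := F) (m := m) (n := n) (r := r) (fun _ => 1) (fun _ => 1)
      simp only [one_mul] at this
      rw [this, Finset.sum_add_distrib]
      simp only [sum_mem_span]
      have h1 : ∀ a : Fin m → Fin n → F, (if tupleRank a = r + 1 then
          (Fintype.card F : ℂ) ^ tupleRank a else 0) =
          (Fintype.card F : ℂ) ^ (r + 1) * if tupleRank a = r + 1 then 1 else 0 := by
        intro a; split_ifs with h <;> simp [h]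
      have h2 : ∀ a : Fin m → Fin n → F, (if tupleRank a = r then
          (∑ _v : Fin n → F, (1 : ℂ)) - (Fintype.card F : ℂ) ^ tupleRank a else 0) =
          ((Fintype.card F : ℂ) ^ n - (Fintype.card F : ℂ) ^ r) *
            if tupleRank a = r then 1 else 0 := by
        intro a; split_ifs with h <;> simp [h]
      simp only [h1, h2, ← Finset.mul_sum, ih]
      rw [gaussBinom, Finset.prod_range_succ]
      push_cast
      ring

open scoped Classical in
/-- The character sum of the trace over square matrices of prescribed rank. -/
theorem sum_character_trace {ψ : AddChar F ℂ} (hψ : ψ ≠ 1) (n r : ℕ) :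
    (∑ a : Fin n → Fin n → F, if tupleRank a = r then ψ (∑ j, a j j) else 0) =
      (-1) ^ r * (Fintype.card F : ℂ) ^ r.choose 2 * gaussBinom (Fintype.card F) n r := by
  induction n generalizing r with
  | zero =>
    cases r with
    | zero => simp [gaussBinom, tupleRank_eq_zero_iff,
        eq_iff_true_of_subsingleton]
    | succ r =>
      have : ∀ a : Fin 0 → Fin 0 → F, tupleRank a ≠ r + 1 := fun a => by
        rw [(tupleRank_eq_zero_iff a).2 (Subsingleton.elim _ _)]; omega
      simp [gaussBinom, this]
  | succ n ih =>
    cases r with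
    | zero => simp [gaussBinom, tupleRank_eq_zero_iff]
    | succ r =>
      have := sum_tupleRank_succ (F := F) (m := n) (n := n + 1) (r := r) (fun v => ψ (v 0))
        (fun a => ψ (∑ j, a j j.succ))
      simp only [← AddChar.map_add_eq_mul, Fin.tail] at this
      simp only [Fin.sum_univ_succ]
      rw [this]
      have h0 : (∑ v : Fin (n + 1) → F, ψ (v 0)) = 0 := by
        rw [← (Fin.consEquiv (fun _ => F)).sum_comp, Fintype.sum_prod_type]
        simp only [Fin.consEquiv_apply, Fin.cons_zero, Finset.sum_const, ← Finset.smul_sum]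
        rw [AddChar.sum_eq_zero_of_ne_one hψ, smul_zero]
      simp only [h0, sum_character_mem_span hψ]
      -- only tuples with vanishing first coordinates contribute
      have hsum : ∀ G : (Fin n → Fin (n + 1) → F) → ℂ, (∀ a, (¬ ∀ j, a j 0 = 0) → G a = 0) →
          ∑ a, G a = ∑ c : Fin n → Fin n → F, G (fun j => Fin.cons 0 (c j)) := by
        intro G hG
        symm
        refine Finset.sum_of_injOn (fun c j => Fin.cons 0 (c j)) ?_ (by simp) ?_ (by simp)
        · intro c _ d _ h
          funext j
          exact (Fin.cons_injective2 (congrFun h j)).2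
        · intro a _ ha
          refine hG a fun h => ha ⟨fun j => Fin.tail (a j), by simp, ?_⟩
          funext j
          rw [← h j]
          exact Fin.cons_self_tail _
      rw [hsum]
      · simp only [tupleRank_comp_cons_zero, Fin.cons_succ, Fin.cons_zero, implies_true, if_true]
        have h1 : ∀ a : Fin n → Fin n → F,
            ((if tupleRank a = r + 1 then ψ (∑ j, a j j) *
              (Fintype.card F : ℂ) ^ tupleRank a else 0) +
            if tupleRank a = r then ψ (∑ j, a j j) *
              (0 - (Fintype.card F : ℂ) ^ tupleRank a) else 0) =
            (Fintype.card F : ℂ) ^ (r + 1) * (if tupleRank a = r + 1 then ψ (∑ j, a j j) else 0) -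
              (Fintype.card F : ℂ) ^ r * (if tupleRank a = r then ψ (∑ j, a j j) else 0) := by
          intro a
          split_ifs with h h' h' <;> simp_all [mul_comm]
        simp only [h1, Finset.sum_sub_distrib, ← Finset.mul_sum, ih]
        have hc : (r + 1).choose 2 = r + r.choose 2 := by
          rw [Nat.choose_succ_succ' r 1, Nat.choose_one_right]
        rw [gaussBinom, hc]
        push_cast
        ring
      · intro a ha
        simp [ha]

open scoped Classical in
/-- The number of square matrices of prescribed rank. -/
theorem card_rank_eq (n r : ℕ) :
    ((Finset.univ.filter fun A : Matrix (Fin n) (Fin n) F => A.rank = r).card : ℚ) =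
      gaussBinom (Fintype.card F) n r *
        ∏ j ∈ Finset.range r, ((Fintype.card F : ℚ) ^ n - (Fintype.card F : ℚ) ^ j) := by
  have h := card_tupleRank (F := F) n n r
  have h2 : (∑ a : Fin n → Fin n → F, if tupleRank a = r then (1 : ℂ) else 0) =
      ((Finset.univ.filter fun A : Matrix (Fin n) (Fin n) F => A.rank = r).card : ℂ) := by
    rw [Finset.card_filter, Nat.cast_sum]
    refine Finset.sum_congr rfl fun A _ => ?_
    change _ = ((if Matrix.rank (Matrix.of A) = r then 1 else 0 : ℕ) : ℂ)
    rw [← tupleRank_eq_rank, Nat.cast_ite, Nat.cast_one, Nat.cast_zero]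
    rfl
  rw [h2] at h
  exact_mod_cast h

open scoped Classical in
/-- The number of traceless square matrices of prescribed rank, by Fourier inversion of the
trace. -/
theorem card_rank_eq_trace_zero (n r : ℕ) :
    (Fintype.card F : ℚ) * (Finset.univ.filter fun A : Matrix (Fin n) (Fin n) F =>
        A.rank = r ∧ A.trace = 0).card =
      gaussBinom (Fintype.card F) n r *
        (∏ j ∈ Finset.range r, ((Fintype.card F : ℚ) ^ n - (Fintype.card F : ℚ) ^ j) +
          ((Fintype.card F : ℚ) - 1) * ((-1) ^ r * (Fintype.card F : ℚ) ^ r.choose 2)) := by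
  obtain ⟨ψ, hψ⟩ : ∃ ψ : AddChar F ℂ, ψ.IsPrimitive :=
    ⟨_, AddChar.FiniteField.primitiveChar_to_Complex_isPrimitive F⟩
  have hinner : ∀ A : Fin n → Fin n → F, (∑ c : F, ψ (c * ∑ j, A j j)) =
      if (∑ j, A j j) = 0 then (Fintype.card F : ℂ) else 0 := by
    intro A
    exact_mod_cast AddChar.sum_mulShift (∑ j, A j j) hψ
  have hL : (∑ c : F, ∑ A : Fin n → Fin n → F,
      if tupleRank A = r then ψ (c * ∑ j, A j j) else 0) =
      (Fintype.card F : ℂ) * (Finset.univ.filter fun A : Matrix (Fin n) (Fin n) F =>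
        A.rank = r ∧ A.trace = 0).card := by
    rw [Finset.sum_comm, Finset.card_filter, Nat.cast_sum, Finset.mul_sum]
    refine Finset.sum_congr rfl fun A _ => ?_
    have : (∑ c : F, if tupleRank A = r then ψ (c * ∑ j, A j j) else 0) =
        if tupleRank A = r then ∑ c : F, ψ (c * ∑ j, A j j) else 0 := by
      split_ifs <;> simp
    rw [this, hinner]
    have h1 : (tupleRank A = r ∧ (∑ j, A j j) = 0) ↔
        (Matrix.rank (Matrix.of A) = r ∧ Matrix.trace (Matrix.of A) = 0) := by
      rw [← tupleRank_eq_rank]; rfl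
    change _ = (Fintype.card F : ℂ) * ((if Matrix.rank (Matrix.of A) = r ∧
      Matrix.trace (Matrix.of A) = 0 then 1 else 0 : ℕ) : ℂ)
    rw [← ite_and, Nat.cast_ite, Nat.cast_one, Nat.cast_zero, mul_ite, mul_one, mul_zero]
    exact if_congr h1 rfl rfl
  have hR : (∑ c : F, ∑ A : Fin n → Fin n → F,
      if tupleRank A = r then ψ (c * ∑ j, A j j) else 0) =
      gaussBinom (Fintype.card F) n r *
        (∏ j ∈ Finset.range r, ((Fintype.card F : ℂ) ^ n - (Fintype.card F : ℂ) ^ j) +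
          ((Fintype.card F : ℂ) - 1) * ((-1) ^ r * (Fintype.card F : ℂ) ^ r.choose 2)) := by
    rw [← Finset.add_sum_erase _ _ (Finset.mem_univ (0 : F))]
    have h1 : ∀ c ∈ Finset.univ.erase (0 : F), (∑ A : Fin n → Fin n → F,
        if tupleRank A = r then ψ (c * ∑ j, A j j) else 0) =
        (-1) ^ r * (Fintype.card F : ℂ) ^ r.choose 2 * gaussBinom (Fintype.card F) n r :=
      fun c hc => sum_character_trace (hψ (Finset.ne_of_mem_erase hc)) n r
    rw [Finset.sum_congr rfl h1]
    simp only [zero_mul, AddChar.map_zero_eq_one, card_tupleRank, Finset.sum_const, nsmul_eq_mul]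
    rw [Finset.card_erase_of_mem (Finset.mem_univ _), Finset.card_univ,
      Nat.cast_pred Fintype.card_pos]
    ring
  have h := hL.symm.trans hR
  exact_mod_cast h

end Rank

/-! ### Sizes of images of matrices -/

section RangeCard

variable {m n : Type*} [Fintype m] [Fintype n] {R : Type*} [CommRing R]

/-- The size of the image of a matrix acting on column vectors. -/
def rangeCard (A : Matrix m n R) : ℕ := Nat.card (LinearMap.range A.mulVecLin)

theorem rangeCard_pos [Finite R] (A : Matrix m n R) : 0 < rangeCard A := Nat.card_pos

omit [Fintype m] in
theorem rangeCard_of_subsingleton [Subsingleton R] (A : Matrix m n R) : rangeCard A = 1 := by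
  have : Subsingleton (m → R) := inferInstance
  exact Nat.card_unique

theorem rangeCard_mul_left [DecidableEq m] {V : Matrix m m R} (hV : IsUnit V)
    (A : Matrix m n R) : rangeCard (V * A) = rangeCard A := by
  have hinj : Function.Injective V.mulVecLin := Matrix.mulVec_injective_of_isUnit hV
  rw [rangeCard, Matrix.mulVecLin_mul, LinearMap.range_comp]
  exact (Nat.card_congr (Submodule.equivMapOfInjective _ hinj _).toEquiv).symm

omit [Fintype m] in
theorem rangeCard_mul_right [DecidableEq n] {U : Matrix n n R} (hU : IsUnit U)
    (A : Matrix m n R) : rangeCard (A * U) = rangeCard A := by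
  have hsurj : LinearMap.range U.mulVecLin = ⊤ :=
    LinearMap.range_eq_top.2 (Matrix.mulVec_surjective_iff_isUnit.2 hU)
  rw [rangeCard, Matrix.mulVecLin_mul, LinearMap.range_comp_of_range_eq_top _ hsurj, rangeCard]

omit [Fintype m] in
theorem rangeCard_submatrix {m' n' : Type*} [Fintype n'] (e : m' ≃ m) (e' : n' ≃ n)
    (A : Matrix m n R) : rangeCard (A.submatrix e e') = rangeCard A := by
  have h : Set.range (A.submatrix e e').mulVec = (fun v => v ∘ e) '' Set.range A.mulVec := by
    ext w
    constructor
    · rintro ⟨v, rfl⟩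
      exact ⟨_, ⟨v ∘ e'.symm, rfl⟩, (Matrix.submatrix_mulVec_equiv A v e e').symm⟩
    · rintro ⟨_, ⟨v, rfl⟩, rfl⟩
      refine ⟨v ∘ e', ?_⟩
      rw [Matrix.submatrix_mulVec_equiv, Function.comp_assoc, Equiv.self_comp_symm]
      rfl
  change Nat.card (Set.range (A.submatrix e e').mulVec) = Nat.card (Set.range A.mulVec)
  rw [h, Nat.card_image_of_injective]
  exact e.surjective.injective_comp_right

theorem rangeCard_of_isUnit [DecidableEq m] {A : Matrix m m R} (hA : IsUnit A) :
    rangeCard A = Nat.card R ^ Fintype.card m := by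
  have hsurj : LinearMap.range A.mulVecLin = ⊤ :=
    LinearMap.range_eq_top.2 (Matrix.mulVec_surjective_iff_isUnit.2 hA)
  rw [rangeCard, hsurj, Nat.card_congr Submodule.topEquiv.toEquiv, Nat.card_fun,
    Nat.card_eq_fintype_card (α := m)]

omit [Fintype m] in
theorem rangeCard_fromBlocks_diag {m' n' : Type*} [Fintype n']
    (A : Matrix m n R) (D : Matrix m' n' R) :
    rangeCard (Matrix.fromBlocks A 0 0 D) = rangeCard A * rangeCard D := by
  have h : Set.range (Matrix.fromBlocks A 0 0 D).mulVec =
      (fun p : (m → R) × (m' → R) => Sum.elim p.1 p.2) ''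
        (Set.range A.mulVec ×ˢ Set.range D.mulVec) := by
    ext w
    constructor
    · rintro ⟨v, rfl⟩
      refine ⟨(A.mulVec (v ∘ Sum.inl), D.mulVec (v ∘ Sum.inr)), ⟨⟨_, rfl⟩, ⟨_, rfl⟩⟩, ?_⟩
      simp only [Matrix.fromBlocks_mulVec, Matrix.zero_mulVec, add_zero, zero_add]
    · rintro ⟨⟨_, _⟩, ⟨⟨u, rfl⟩, ⟨v, rfl⟩⟩, rfl⟩
      exact ⟨Sum.elim u v, by simp [Matrix.fromBlocks_mulVec]⟩
  change Nat.card (Set.range (Matrix.fromBlocks A 0 0 D).mulVec) =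
    Nat.card (Set.range A.mulVec) * Nat.card (Set.range D.mulVec)
  rw [h, Nat.card_image_of_injective, Nat.card_congr (Equiv.Set.prod _ _), Nat.card_prod]
  rintro ⟨u, v⟩ ⟨u', v'⟩ h
  have h : Sum.elim u v = Sum.elim u' v' := h
  rw [Sum.elim_eq_iff] at h
  exact Prod.ext h.1 h.2

end RangeCard

/-! ### Lifting matrices along a small extension of local rings -/

/-- A ring `R` over a field `k` together with a quotient ring `S` of `R` such that the kernel of
`R → k` is, as an `R`-module, a copy of `S`. The relevant instance is `R = 𝔬 / 𝔭^(M+1)`,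
`S = 𝔬 / 𝔭^M`, where the embedding `S → R` is multiplication by a uniformizer. -/
structure SmallExtension (R S k : Type*) [CommRing R] [CommRing S] [Field k] where
  /-- the reduction map to the residue field -/
  red : R →+* k
  /-- the projection to the lower level -/
  down : R →+* S
  /-- the embedding of the lower level onto the kernel of the reduction map -/
  emb : S →+ R
  /-- the reduction map is onto -/
  red_surjective : Function.Surjective red
  /-- the projection is onto -/
  down_surjective : Function.Surjective down
  /-- the embedding is injective -/
  emb_injective : Function.Injective emb
  /-- the embedding is `R`-linear -/
  emb_down_mul : ∀ r s, emb (down r * s) = r * emb s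
  /-- the kernel of the reduction map is the image of the embedding -/
  red_eq_zero_iff : ∀ r, red r = 0 ↔ ∃ s, emb s = r

namespace SmallExtension

variable {R S k : Type*} [CommRing R] [CommRing S] [Field k] (E : SmallExtension R S k)
variable {m n : Type*} [Fintype m] [Fintype n] [DecidableEq m] [DecidableEq n]

theorem red_emb (s : S) : E.red (E.emb s) = 0 := (E.red_eq_zero_iff _).2 ⟨s, rfl⟩

omit [Fintype m] [DecidableEq m] [Fintype n] [DecidableEq n] in
theorem exists_map_red (A : Matrix m n k) : ∃ B : Matrix m n R, B.map E.red = A := by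
  choose g hg using E.red_surjective
  exact ⟨A.map g, by ext; simp [hg]⟩

omit [Fintype m] [DecidableEq m] [Fintype n] [DecidableEq n] in
theorem map_red_eq_zero_iff (A : Matrix m n R) :
    A.map E.red = 0 ↔ ∃ s : Matrix m n S, s.map E.emb = A := by
  constructor
  · intro h
    choose s hs using fun i j => (E.red_eq_zero_iff (A i j)).1 (congrFun (congrFun h i) j)
    exact ⟨Matrix.of s, by ext; simp [hs]⟩
  · rintro ⟨s, rfl⟩
    ext; simp [red_emb]

omit [Fintype m] [DecidableEq m] [DecidableEq n] in
theorem mulVec_map_emb (s : Matrix m n S) (v : n → R) :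
    (s.map E.emb).mulVec v = E.emb ∘ s.mulVec (E.down ∘ v) := by
  ext i
  simp [Matrix.mulVec, dotProduct, map_sum, mul_comm (s i _), emb_down_mul, mul_comm (E.emb _)]

omit [Fintype m] [DecidableEq m] [DecidableEq n] in
theorem rangeCard_map_emb (s : Matrix m n S) : rangeCard (s.map E.emb) = rangeCard s := by
  have h : Set.range (s.map E.emb).mulVec = (fun v => E.emb ∘ v) '' Set.range s.mulVec := by
    ext w
    constructor
    · rintro ⟨v, rfl⟩
      exact ⟨_, ⟨E.down ∘ v, rfl⟩, (E.mulVec_map_emb s v).symm⟩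
    · rintro ⟨_, ⟨v, rfl⟩, rfl⟩
      obtain ⟨u, rfl⟩ := E.down_surjective.comp_left v
      exact ⟨u, E.mulVec_map_emb s u⟩
  change Nat.card (Set.range (s.map E.emb).mulVec) = Nat.card (Set.range s.mulVec)
  rw [h, Nat.card_image_of_injective]
  exact E.emb_injective.comp_left

theorem isUnit_of_isUnit_map_red [IsLocalRing R] {A : Matrix n n R} (h : IsUnit (A.map E.red)) :
    IsUnit A := by
  have := IsLocalHom.of_surjective E.red E.red_surjective
  rw [Matrix.isUnit_iff_isUnit_det] at h ⊢
  have hd : E.red A.det = (A.map E.red).det := RingHom.map_det _ _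
  rw [← hd] at h
  exact isUnit_of_map_unit _ _ h

section Sums

variable {M : Type*} [CommSemiring M]

/-- The block `1 + 𝔭` is invertible, so the size of the image is governed by the Schur
complement. -/
theorem sum_schurComplement [Fintype S] [IsLocalRing R] (W : ℕ → M)
    (a : Matrix m m S) (b : Matrix m n S) (c : Matrix n m S) :
    ∑ d : Matrix n n S, W (rangeCard (Matrix.fromBlocks (1 + a.map E.emb) (b.map E.emb)
      (c.map E.emb) (d.map E.emb))) =
    ∑ d : Matrix n n S, W (Nat.card R ^ Fintype.card m * rangeCard d) := by
  have hA : IsUnit (1 + a.map E.emb) := by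
    apply E.isUnit_of_isUnit_map_red
    have : (1 + a.map E.emb).map E.red = 1 := by
      rw [Matrix.map_add _ (map_add E.red), (E.map_red_eq_zero_iff _).2 ⟨a, rfl⟩, add_zero]
      exact Matrix.map_one _ (map_zero _) (map_one _)
    rw [this]; exact isUnit_one
  let := hA.invertible
  obtain ⟨t, ht⟩ := (E.map_red_eq_zero_iff
    (c.map E.emb * ⅟(1 + a.map E.emb) * b.map E.emb)).1 (by
      rw [Matrix.map_mul, (E.map_red_eq_zero_iff (b.map E.emb)).2 ⟨b, rfl⟩, Matrix.mul_zero])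
  rw [← Equiv.sum_comp (Equiv.addRight t)]
  refine Finset.sum_congr rfl fun d _ => congrArg W ?_
  have hL : IsUnit (Matrix.fromBlocks (1 : Matrix m m R) 0
      (c.map E.emb * ⅟(1 + a.map E.emb)) (1 : Matrix n n R)) := by
    rw [Matrix.isUnit_iff_isUnit_det, Matrix.det_fromBlocks_zero₁₂]; simp
  have hU : IsUnit (Matrix.fromBlocks (1 : Matrix m m R)
      (⅟(1 + a.map E.emb) * b.map E.emb) 0 (1 : Matrix n n R)) := by
    rw [Matrix.isUnit_iff_isUnit_det, Matrix.det_fromBlocks_zero₂₁]; simp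
  rw [Matrix.fromBlocks_eq_of_invertible₁₁, rangeCard_mul_right hU, rangeCard_mul_left hL,
    rangeCard_fromBlocks_diag, rangeCard_of_isUnit hA, ← ht, ← Matrix.map_sub _ (map_sub E.emb),
    rangeCard_map_emb, Equiv.coe_addRight, add_sub_cancel_right]

variable [Fintype R] [Fintype S]

open scoped Classical in
theorem sum_lifts {B : Matrix m n R} {A : Matrix m n k} (hB : B.map E.red = A)
    (G : Matrix m n R → M) :
    ∑ A' with A'.map E.red = A, G A' = ∑ s : Matrix m n S, G (B + s.map E.emb) := by
  symm
  refine Finset.sum_nbij (fun s => B + s.map E.emb) ?_ ?_ ?_ (fun _ _ => rfl)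
  · intro s _
    rw [Finset.mem_filter]
    refine ⟨Finset.mem_univ _, ?_⟩
    rw [← hB]; ext; simp [red_emb]
  · intro s _ t _ h
    ext i j
    exact E.emb_injective (by simpa using congrFun (congrFun h i) j)
  · intro A' hA'
    have hA' : A'.map E.red = A := (Finset.mem_filter.1 hA').2
    obtain ⟨s, hs⟩ := (E.map_red_eq_zero_iff (A' - B)).1 (by
      rw [Matrix.map_sub _ (map_sub E.red), hA', hB, sub_self])
    exact ⟨s, Finset.mem_coe.2 (Finset.mem_univ _), by simp [hs]⟩

theorem sum_fromBlocks {α : Type*} [Fintype α] (G : Matrix (m ⊕ n) (m ⊕ n) α → M) :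
    ∑ s, G s = ∑ a : Matrix m m α, ∑ b : Matrix m n α, ∑ c : Matrix n m α, ∑ d : Matrix n n α,
      G (Matrix.fromBlocks a b c d) := by
  let e : Matrix m m α × Matrix m n α × Matrix n m α × Matrix n n α ≃
      Matrix (m ⊕ n) (m ⊕ n) α :=
    { toFun := fun p => Matrix.fromBlocks p.1 p.2.1 p.2.2.1 p.2.2.2
      invFun := fun s => (s.toBlocks₁₁, s.toBlocks₁₂, s.toBlocks₂₁, s.toBlocks₂₂)
      left_inv := fun p => by simp
      right_inv := fun s => Matrix.fromBlocks_toBlocks s }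
  rw [← e.sum_comp]
  simp only [Fintype.sum_prod_type]
  rfl

omit [CommRing S] in
theorem card_matrix :
    Fintype.card (Matrix m n S) = Nat.card S ^ (Fintype.card n * Fintype.card m) := by
  rw [← Nat.card_eq_fintype_card, Matrix, Nat.card_fun, Nat.card_fun, ← pow_mul,
    Nat.card_eq_fintype_card (α := m), Nat.card_eq_fintype_card (α := n)]

omit [Fintype R] in
theorem sum_lifts_normal_form [IsLocalRing R] (W : ℕ → M) :
    ∑ s : Matrix (m ⊕ n) (m ⊕ n) S,
      W (rangeCard (Matrix.fromBlocks 1 0 0 0 + s.map E.emb)) =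
    (Nat.card S : M) ^ ((Fintype.card m + Fintype.card n) ^ 2 - Fintype.card n ^ 2) *
      ∑ d : Matrix n n S, W (Nat.card R ^ Fintype.card m * rangeCard d) := by
  rw [sum_fromBlocks]
  simp only [Matrix.fromBlocks_map, Matrix.fromBlocks_add, zero_add, E.sum_schurComplement]
  simp only [Finset.sum_const, Finset.card_univ, nsmul_eq_mul, card_matrix]
  have : (Fintype.card m + Fintype.card n) ^ 2 - Fintype.card n ^ 2 =
      Fintype.card m * Fintype.card m + Fintype.card m * Fintype.card n +
        Fintype.card n * Fintype.card m := by
    rw [Nat.sub_eq_iff_eq_add (Nat.pow_le_pow_left (Nat.le_add_left _ _) 2)]; ring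
  rw [this]
  push_cast
  ring

open scoped Classical in
/-- The distribution of the sizes of images among the lifts of a matrix over the residue field
depends only on the rank `n - i` of that matrix, and is given by the `i × i`-matrices over the
lower level. -/
theorem sum_lifts_rangeCard [IsLocalRing R] (W : ℕ → M) {n i : ℕ} (hi : i ≤ n)
    {A : Matrix (Fin n) (Fin n) k} (hA : A.rank = n - i) :
    ∑ A' with A'.map E.red = A, W (rangeCard A') =
      (Nat.card S : M) ^ (n ^ 2 - i ^ 2) *
        ∑ d : Matrix (Fin i) (Fin i) S, W (Nat.card R ^ (n - i) * rangeCard d) := by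
  have hnf := Matrix.exists_rank_normal_form A
  rw [Fintype.card_fin, hA, Nat.sub_sub_self hi] at hnf
  obtain ⟨V, U, e, hV, hU, hVU⟩ := hnf
  obtain ⟨V', rfl⟩ := E.exists_map_red V
  obtain ⟨U', rfl⟩ := E.exists_map_red U
  obtain ⟨v, rfl⟩ := E.isUnit_of_isUnit_map_red hV
  obtain ⟨u, rfl⟩ := E.isUnit_of_isUnit_map_red hU
  let N : Matrix (Fin (n - i) ⊕ Fin i) (Fin (n - i) ⊕ Fin i) R := Matrix.fromBlocks 1 0 0 0
  have hN : (N.submatrix e e).map E.red = (Matrix.fromBlocks 1 0 0 0).submatrix e e := by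
    rw [← Matrix.submatrix_map, Matrix.fromBlocks_map]
    simp
  calc ∑ A' with A'.map E.red = A, W (rangeCard A')
      = ∑ A' with A'.map E.red = (Matrix.fromBlocks 1 0 0 0).submatrix e e,
          W (rangeCard A') := by
        refine Finset.sum_nbij' (fun A' => v.val * A' * u.val)
          (fun A' => v⁻¹.val * A' * u⁻¹.val) ?_ ?_ ?_ ?_ ?_
        · intro A' h
          simp only [Finset.mem_filter, Finset.mem_univ, true_and] at h ⊢
          rw [Matrix.map_mul, Matrix.map_mul, h, hVU]
        · intro A' h
          simp only [Finset.mem_filter, Finset.mem_univ, true_and] at h ⊢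
          refine hV.mul_left_cancel (hU.mul_right_cancel ?_)
          rw [hVU, ← Matrix.map_mul, ← Matrix.map_mul, ← h]
          simp [mul_assoc]
        · intro A' _; simp [mul_assoc]
        · intro A' _; simp [mul_assoc]
        · intro A' _
          rw [rangeCard_mul_right u.isUnit, rangeCard_mul_left v.isUnit]
    _ = ∑ s : Matrix (Fin (n - i) ⊕ Fin i) (Fin (n - i) ⊕ Fin i) S,
          W (rangeCard (N + s.map E.emb)) := by
        rw [E.sum_lifts hN, ← (Matrix.reindex e.symm e.symm).sum_comp]
        refine Finset.sum_congr rfl fun s _ => ?_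
        rw [← rangeCard_submatrix e e (N + s.map E.emb)]
        rfl
    _ = _ := by
        rw [E.sum_lifts_normal_form, Fintype.card_fin, Fintype.card_fin, Nat.sub_add_cancel hi]

open scoped Classical in
/-- Among the lifts of a nonzero traceless matrix, the trace is equidistributed, and
independent of the size of the image. -/
theorem card_mul_sum_traceless_lifts [IsLocalRing R] (W : ℕ → M) {A : Matrix n n k} (hA : A ≠ 0)
    (htr : A.trace = 0) :
    (Nat.card S : M) * ∑ A' with A'.map E.red = A ∧ A'.trace = 0, W (rangeCard A') =
      ∑ A' with A'.map E.red = A, W (rangeCard A') := by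
  have hloc := IsLocalHom.of_surjective E.red E.red_surjective
  obtain ⟨i, j, hij⟩ : ∃ i j, A i j ≠ 0 := by
    by_contra! h; exact hA (by ext; simp [h])
  -- `P s` multiplies a lift `A'` by a unit and changes its trace by `s` times the unit `A' i j`
  let P : S → Matrix n n R := fun s => 1 + E.emb s • Matrix.single j i 1
  have hPred : ∀ s, (P s).map E.red = 1 := by
    intro s
    ext a b
    simp [P, Matrix.one_apply, apply_ite E.red, Matrix.single_apply, red_emb]
  have hP : ∀ s, IsUnit (P s) := fun s =>
    E.isUnit_of_isUnit_map_red (by rw [hPred]; exact isUnit_one)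
  have hPtr : ∀ s (A' : Matrix n n R), (P s * A').trace = A'.trace + E.emb s * A' i j := by
    intro s A'
    simp [P, add_mul, Matrix.trace_add, Matrix.trace_single_mul]
  -- every lift is moved to a traceless one by exactly one `P s`
  have huniq : ∀ A' : Matrix n n R, A'.map E.red = A → ∃! s, (P s * A').trace = 0 := by
    intro A' hA'
    obtain ⟨τ, hτ⟩ := (E.red_eq_zero_iff A'.trace).1 (by
      have h : E.red A'.trace = (A'.map E.red).trace := AddMonoidHom.map_trace E.red.toAddMonoidHom A'
      rw [h, hA', htr])
    have hu : IsUnit (A' i j) := by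
      apply isUnit_of_map_unit E.red
      rw [isUnit_iff_ne_zero]
      have : E.red (A' i j) = A i j := by rw [← hA']; rfl
      rwa [this]
    obtain ⟨u, hu⟩ := hu.map E.down
    have h1 : ∀ s, (P s * A').trace = 0 ↔ τ + u * s = 0 := by
      intro s
      rw [hPtr, ← hτ, mul_comm, ← E.emb_down_mul, ← map_add, hu,
        map_eq_zero_iff _ E.emb_injective]
    refine ⟨-(↑u⁻¹ * τ), (h1 _).2 (by simp), fun s hs => ?_⟩
    have h2 : (u : S) * s = -τ := (eq_neg_of_add_eq_zero_right ((h1 s).1 hs))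
    rw [← mul_neg, ← h2, Units.inv_mul_cancel_left]
  have hstep : ∀ s, ∑ A' with A'.map E.red = A,
      (if (P s * A').trace = 0 then W (rangeCard A') else 0) =
      ∑ A' with A'.map E.red = A ∧ A'.trace = 0, W (rangeCard A') := by
    intro s
    rw [← Finset.sum_filter, Finset.filter_filter]
    obtain ⟨v, hv⟩ := hP s
    have hvr : v⁻¹.val.map E.red = 1 := by
      have h : ((P s) * v⁻¹.val).map E.red = 1 := by
        rw [← hv, Units.mul_inv]; exact Matrix.map_one _ (map_zero _) (map_one _)
      rwa [Matrix.map_mul, hPred, one_mul] at h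
    refine Finset.sum_nbij' (fun A' => P s * A') (fun A' => v⁻¹.val * A') ?_ ?_ ?_ ?_ ?_
    · intro A' h
      simp only [Finset.mem_filter, Finset.mem_univ, true_and] at h ⊢
      exact ⟨by rw [Matrix.map_mul, hPred, one_mul, h.1], h.2⟩
    · intro A' h
      simp only [Finset.mem_filter, Finset.mem_univ, true_and] at h ⊢
      refine ⟨by rw [Matrix.map_mul, hvr, one_mul, h.1], ?_⟩
      rw [← hv, Units.mul_inv_cancel_left]; exact h.2
    · intro A' _
      rw [← hv, Units.inv_mul_cancel_left]
    · intro A' _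
      rw [← hv, Units.mul_inv_cancel_left]
    · intro A' _
      rw [rangeCard_mul_left (hP s)]
  calc (Nat.card S : M) * ∑ A' with A'.map E.red = A ∧ A'.trace = 0, W (rangeCard A')
      = ∑ s : S, ∑ A' with A'.map E.red = A,
          (if (P s * A').trace = 0 then W (rangeCard A') else 0) := by
        rw [Finset.sum_congr rfl fun s _ => hstep s, Finset.sum_const, nsmul_eq_mul,
          Finset.card_univ, Nat.card_eq_fintype_card]
    _ = _ := by
        rw [Finset.sum_comm]
        refine Finset.sum_congr rfl fun A' h => ?_
        obtain ⟨s, hs, hs'⟩ := huniq A' (Finset.mem_filter.1 h).2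
        rw [Finset.sum_eq_single s (fun t _ ht => if_neg fun h => ht (hs' t h)) (by simp),
          if_pos hs]

end Sums

end SmallExtension

/-! ### Identities between `X`-binomial coefficients -/

section Identities

/-- The `X`-Pochhammer symbol `∏_{j=1}^{k} (1 - X^j)`. -/
def qPoch {K : Type*} [Field K] (X : K) (k : ℕ) : K := ∏ j ∈ Finset.range k, (1 - X ^ (j + 1))

variable {K : Type*} [Field K] {X : K}

theorem qPoch_succ (k : ℕ) : qPoch X (k + 1) = qPoch X k * (1 - X ^ (k + 1)) :=
  Finset.prod_range_succ _ _

theorem qPoch_ne_zero (hX : ∀ j : ℕ, 1 - X ^ (j + 1) ≠ 0) (k : ℕ) : qPoch X k ≠ 0 :=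
  Finset.prod_ne_zero_iff.2 fun j _ => hX j

theorem qPoch_add (i r : ℕ) :
    qPoch X (i + r) = qPoch X i * ∏ j ∈ Finset.range r, (1 - X ^ (i + j + 1)) :=
  Finset.prod_range_add _ _ _

theorem prod_Ioc_one_sub_pow (i r : ℕ) :
    ∏ j ∈ Finset.Ioc i (i + r), (1 - X ^ j) = ∏ j ∈ Finset.range r, (1 - X ^ (i + j + 1)) := by
  induction r with
  | zero => simp
  | succ r ih =>
    rw [Finset.prod_range_succ, ← ih, ← add_assoc, ← Finset.insert_Ioc_right_eq_Ioc_add_one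
      (Nat.le_add_right i r), Finset.prod_insert (by simp), mul_comm]

theorem qBinom_mul_qPoch (hX : ∀ j : ℕ, 1 - X ^ (j + 1) ≠ 0) (i r : ℕ) :
    qBinom (i + r) i X * (qPoch X i * qPoch X r) = qPoch X (i + r) := by
  have h : qBinom (i + r) i X = ∏ j ∈ Finset.range i, (1 - X ^ (r + j + 1)) / (1 - X ^ (j + 1)) := by
    have hIcc : ∀ (g : ℕ → K) (i : ℕ),
        ∏ j ∈ Finset.Icc 1 i, g j = ∏ j ∈ Finset.range i, g (j + 1) := by
      intro g i
      induction i with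
      | zero => simp
      | succ i ih => rw [Finset.prod_Icc_succ_top (by omega), ih, Finset.prod_range_succ]
    rw [qBinom, Nat.add_sub_cancel_left, hIcc]
    simp only [add_assoc]
  rw [h, Finset.prod_div_distrib, add_comm i r, qPoch_add, mul_comm (qPoch X r)]
  change _ / qPoch X i * _ = _
  field_simp [qPoch_ne_zero hX i]

theorem qBinom_self (hX : ∀ j : ℕ, 1 - X ^ (j + 1) ≠ 0) (i : ℕ) : qBinom i i X = 1 := by
  have h := qBinom_mul_qPoch hX i 0
  rw [add_zero, show qPoch X 0 = 1 from rfl, mul_one] at h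
  exact mul_right_cancel₀ (qPoch_ne_zero hX i) (h.trans (one_mul _).symm)

theorem gaussBinom_of_lt (q : ℕ) {n r : ℕ} (h : n < r) : gaussBinom q n r = 0 := by
  induction n generalizing r with
  | zero => obtain ⟨r, rfl⟩ := Nat.exists_eq_succ_of_ne_zero h.ne'; rfl
  | succ n ih =>
    obtain ⟨r, rfl⟩ := Nat.exists_eq_succ_of_ne_zero (Nat.ne_zero_of_lt h)
    rw [gaussBinom, ih (by omega), ih (by omega), mul_zero]

theorem gaussBinom_mul_qPoch {q : ℕ} (hqX : (q : K) * X = 1) (i r : ℕ) :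
    (gaussBinom q (i + r) r : K) * (qPoch X i * qPoch X r) = q ^ (i * r) * qPoch X (i + r) := by
  obtain ⟨n, hn⟩ : ∃ n, n = i + r := ⟨_, rfl⟩
  induction n generalizing i r with
  | zero =>
    obtain ⟨rfl, rfl⟩ : i = 0 ∧ r = 0 := by omega
    simp [gaussBinom, qPoch]
  | succ n ih =>
    rcases r with _ | r
    · simp [gaussBinom, qPoch]
    rcases i with _ | i
    · have h := ih 0 r (by omega)
      rw [zero_add] at h ⊢
      rw [gaussBinom, gaussBinom_of_lt q (Nat.lt_succ_self r), qPoch_succ]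
      push_cast
      linear_combination (1 - X ^ (r + 1)) * h
    · have h1 := ih i (r + 1) (by omega)
      have h2 := ih (i + 1) r (by omega)
      rw [show i + (r + 1) = i + r + 1 by ring] at h1
      rw [show i + 1 + r = i + r + 1 by ring] at h2
      rw [show i + 1 + (r + 1) = (i + r + 1) + 1 by ring, gaussBinom, qPoch_succ (i + r + 1)]
      rw [qPoch_succ i] at h2 ⊢
      rw [qPoch_succ r] at h1 ⊢
      have hp : (q : K) ^ (i + 1) * X ^ (i + 1) = 1 := by rw [← mul_pow, hqX, one_pow]
      push_cast
      have e1 : (q : K) ^ ((i + 1) * (r + 1)) = q ^ (i * (r + 1)) * q ^ (r + 1) := by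
        rw [← pow_add]; congr 1; ring
      have e2 : (q : K) ^ ((i + 1) * (r + 1)) = q ^ ((i + 1) * r) * q ^ (i + 1) := by
        rw [← pow_add]; congr 1
      have e3 : X ^ (i + r + 1 + 1) = X ^ (i + 1) * X ^ (r + 1) := by
        rw [← pow_add]; congr 1; ring
      rw [e3]
      linear_combination (q : K) ^ (r + 1) * (1 - X ^ (i + 1)) * h1 + (1 - X ^ (r + 1)) * h2
        - qPoch X (i + r + 1) * (1 - X ^ (i + 1)) * e1
        - qPoch X (i + r + 1) * X ^ (i + 1) * (1 - X ^ (r + 1)) * e2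
        - qPoch X (i + r + 1) * (1 - X ^ (r + 1)) * q ^ ((i + 1) * r) * hp

theorem gaussBinom_eq (hX : ∀ j : ℕ, 1 - X ^ (j + 1) ≠ 0) {q : ℕ} (hqX : (q : K) * X = 1)
    (i r : ℕ) : (gaussBinom q (i + r) r : K) = q ^ (i * r) * qBinom (i + r) i X := by
  refine mul_right_cancel₀ (mul_ne_zero (qPoch_ne_zero hX i) (qPoch_ne_zero hX r)) ?_
  rw [gaussBinom_mul_qPoch hqX, mul_assoc, qBinom_mul_qPoch hX]

theorem prod_pow_sub_pow {q : ℕ} (hqX : (q : K) * X = 1) (i r : ℕ) :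
    ∏ j ∈ Finset.range r, ((q : K) ^ (i + r) - (q : K) ^ j) =
      q ^ (r * (i + r)) * ∏ j ∈ Finset.Ioc i (i + r), (1 - X ^ j) := by
  rw [prod_Ioc_one_sub_pow, ← Finset.prod_range_reflect (fun j => 1 - X ^ (i + j + 1)),
    mul_comm r, pow_mul, ← Finset.card_range r, ← Finset.prod_const, Finset.card_range,
    ← Finset.prod_mul_distrib]
  refine Finset.prod_congr rfl fun j hj => ?_
  have hj := Finset.mem_range.1 hj
  have h1 : i + (r - 1 - j) + 1 = i + r - j := by omega
  have h2 : (q : K) ^ (i + r) = q ^ j * q ^ (i + r - j) := by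
    rw [← pow_add]; congr 1; omega
  have h3 : (q : K) ^ (i + r - j) * X ^ (i + r - j) = 1 := by rw [← mul_pow, hqX, one_pow]
  rw [h1, mul_sub, mul_one]
  linear_combination (q : K) ^ j * h3 + X ^ (i + r - j) * h2

theorem f_singleton (n i : ℕ) :
    f n {i} X = qBinom n i X * ∏ j ∈ Finset.Ioc i n, (1 - X ^ j) := by
  have h : WithTop.untopD n (i : WithTop ℕ) = i := rfl
  simp [f, qMultinom, qMultinomList, h]

theorem f_singleton_self (hX : ∀ j : ℕ, 1 - X ^ (j + 1) ≠ 0) (i : ℕ) : f i {i} X = 1 := by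
  rw [f_singleton, qBinom_self hX]; simp

theorem f_empty (n : ℕ) : f n ∅ X = 1 := by simp [f, qMultinom, qMultinomList]

/-- The functions `f_{n,I}` are multiplicative along the largest element of `I`. -/
theorem f_insert {n j : ℕ} (hj : j ≤ n) {J : Finset ℕ} (hJ : J ⊆ Finset.range j) :
    f n (insert j J) X = f n {j} X * f j J X := by
  have hlt : ∀ i ∈ J, i < j := fun i hi => Finset.mem_range.1 (hJ hi)
  have hsort : (insert j J).sort (· ≥ ·) = j :: J.sort (· ≥ ·) :=
    Finset.sort_insert (r := (· ≥ ·)) (fun i hi => (hlt i hi).le) fun h => (hlt j h).false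
  have hmin : (insert j J).min.untopD n = J.min.untopD j ∧ J.min.untopD j ≤ j := by
    rw [Finset.min_insert]
    rcases J.eq_empty_or_nonempty with rfl | h
    · exact ⟨by simp; rfl, by simp⟩
    · rw [← Finset.coe_min' h]
      have := hlt _ (J.min'_mem h)
      rw [min_eq_right (by exact_mod_cast this.le)]
      exact ⟨rfl, this.le⟩
  rw [f_singleton, f, f, hmin.1, qMultinom, hsort, qMultinomList,
    ← Finset.prod_Ioc_consecutive _ hmin.2 hj, qMultinom]
  ring

/-- The number of matrices of rank `n - i` over a field with `q` elements, in terms of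
`f_{n,{i}}(q⁻¹)`. -/
theorem pow_sq_sub_sq_mul_f {q : ℕ} (hX : ∀ j : ℕ, 1 - X ^ (j + 1) ≠ 0) (hqX : (q : K) * X = 1)
    {n i : ℕ} (hi : i ≤ n) :
    (gaussBinom q n (n - i) : K) * ∏ j ∈ Finset.range (n - i), ((q : K) ^ n - (q : K) ^ j) =
      q ^ (n ^ 2 - i ^ 2) * f n {i} X := by
  obtain ⟨r, rfl⟩ := Nat.exists_eq_add_of_le hi
  have he : (i + r) ^ 2 - i ^ 2 = i * r + r * (i + r) := by
    rw [Nat.sub_eq_iff_eq_add (Nat.pow_le_pow_left hi 2)]; ring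
  rw [Nat.add_sub_cancel_left, gaussBinom_eq hX hqX, prod_pow_sub_pow hqX, f_singleton, he,
    pow_add]
  ring

/-- The number of traceless matrices of rank `n - i` over a field with `q` elements, multiplied by
`q`, in terms of `b_{n,i}(q⁻¹)`. -/
theorem pow_sq_sub_sq_mul_b {q : ℕ} (hX : ∀ j : ℕ, 1 - X ^ (j + 1) ≠ 0) (hqX : (q : K) * X = 1)
    {n i : ℕ} (hi : i < n) :
    (gaussBinom q n (n - i) : K) *
        (∏ j ∈ Finset.range (n - i), ((q : K) ^ n - (q : K) ^ j) +
          ((q : K) - 1) * ((-1) ^ (n - i) * (q : K) ^ (n - i).choose 2)) =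
      q ^ (n ^ 2 - i ^ 2) * b n i X := by
  rw [mul_add, pow_sq_sub_sq_mul_f hX hqX hi.le, b, mul_add]
  congr 1
  obtain ⟨r, rfl⟩ := Nat.exists_eq_add_of_le hi.le
  have hr : 1 ≤ r := by omega
  rw [Nat.add_sub_cancel_left, gaussBinom_eq hX hqX]
  set e := (i + r + 1).choose 2 - (i + 1).choose 2 - 1 with he
  have hexp : (i + r) ^ 2 - i ^ 2 = i * r + 1 + r.choose 2 + e := by
    have h1 : ∀ m : ℕ, 2 * (m + 1).choose 2 = m * (m + 1) := fun m => by
      rw [Nat.choose_two_right, Nat.add_sub_cancel,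
        Nat.mul_div_cancel' (by simpa using (Nat.even_mul_pred_self (m + 1)).two_dvd), mul_comm]
    have h2 := h1 (i + r)
    have h3 := h1 i
    have h4 : 2 * r.choose 2 + r = r * r := by
      obtain ⟨s, rfl⟩ := Nat.exists_eq_add_of_le' hr
      rw [h1]; ring
    have h5 : (i + r) ^ 2 - i ^ 2 = 2 * (i * r) + r * r := by
      rw [Nat.sub_eq_iff_eq_add (Nat.pow_le_pow_left hi.le 2)]; ring
    -- with this expansion the claim is linear in the products involved
    have h6 : (i + r) * (i + r + 1) = i * (i + 1) + 2 * (i * r) + r * r + r := by ring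
    omega
  have h1 : (q : K) ^ e * X ^ e = 1 := by rw [← mul_pow, hqX, one_pow]
  rw [hexp, pow_add, pow_add, pow_add, pow_one]
  linear_combination (q : K) ^ (i * r) * qBinom (i + r) i X * (-1) ^ r * q ^ r.choose 2 *
    (hqX - (q - q * X) * h1)

end Identities

/-! ### Summation of the recursion -/

section Summation

open scoped PowerSeries.WithPiTopology

theorem one_sub_x_mul_inv (q : ℕ) {n i : ℕ} (hi : i < n) :
    (1 - x q n i) * (1 - x q n i)⁻¹ = 1 := by
  refine PowerSeries.mul_inv_cancel _ ?_
  simp [x, (Nat.sub_pos_of_lt hi).ne']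

theorem X_pow_dvd_x_pow (q : ℕ) {n i : ℕ} (hi : i < n) (M : ℕ) : X ^ M ∣ x q n i ^ M := by
  refine pow_dvd_pow_of_dvd (Dvd.dvd.mul_left ?_ _) M
  exact dvd_pow_self _ (Nat.sub_pos_of_lt hi).ne'

/-- A series of power series whose `M`-th term is divisible by `X ^ M` converges. -/
theorem summable_of_X_pow_dvd {a : ℕ → ℚ⟦X⟧} (h : ∀ M, X ^ M ∣ a M) : Summable a := by
  rw [PowerSeries.WithPiTopology.summable_iff_summable_coeff]
  intro d
  refine summable_of_hasFiniteSupport ((Set.finite_Iic d).subset fun M hM => ?_)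
  by_contra hd
  exact hM (X_pow_dvd_iff.1 (h M) d (not_le.1 hd))

theorem sum_powerset_range_eq (g : Finset ℕ → ℚ⟦X⟧) (i : ℕ) :
    ∑ J ∈ (Finset.range i).powerset, g J =
      g ∅ + ∑ j ∈ Finset.range i, ∑ J ∈ (Finset.range j).powerset, g (insert j J) := by
  induction i with
  | zero => simp
  | succ i ih =>
    rw [Finset.range_add_one, Finset.sum_powerset_insert (by simp), ih,
      Finset.sum_insert (by simp)]
    ring

/-- The sum over all subsets `J` of `{0, …, i-1}` in the explicit formula, split according to the
largest element of `J`. -/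
theorem sum_powerset_f_gp (q n i : ℕ) (Y : ℚ) :
    ∑ J ∈ (Finset.range i).powerset, C (f i J Y) * ∏ j ∈ J, gp (x q n j) =
      1 + ∑ j ∈ Finset.range i, C (f i {j} Y) * gp (x q n j) *
        ∑ J ∈ (Finset.range j).powerset, C (f j J Y) * ∏ l ∈ J, gp (x q n l) := by
  rw [sum_powerset_range_eq, f_empty]
  congr 1
  · simp
  refine Finset.sum_congr rfl fun j hj => ?_
  rw [Finset.mul_sum]
  refine Finset.sum_congr rfl fun J hJ => ?_
  have hJ := Finset.mem_powerset.1 hJ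
  rw [f_insert (Finset.mem_range.1 hj).le hJ, Finset.prod_insert fun h => by simpa using hJ h,
    map_mul]
  ring

/-- If the polynomials `Z i M` satisfy the recursion of the image zeta functions of all
`i × i`-matrices, their generating series are given by the explicit sum over subsets. -/
theorem tsum_x_pow_mul {q n : ℕ} {Z : ℕ → ℕ → ℚ⟦X⟧} {Y : ℚ}
    (hY : ∀ j : ℕ, 1 - Y ^ (j + 1) ≠ 0) (hZ : ∀ i, Z i 0 = 1)
    (hrec : ∀ i < n, ∀ M, x q n i ^ (M + 1) * Z i (M + 1) =
      ∑ j ∈ Finset.range (i + 1), C (f i {j} Y) * x q n j * (x q n j ^ M * Z j M))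
    {i : ℕ} (hi : i < n) :
    x q n i * ∑' M, x q n i ^ M * Z i M = gp (x q n i) *
      ∑ J ∈ (Finset.range i).powerset, C (f i J Y) * ∏ j ∈ J, gp (x q n j) := by
  have hs : ∀ j < n, Summable fun M => x q n j ^ M * Z j M := fun j hj =>
    summable_of_X_pow_dvd fun M => (X_pow_dvd_x_pow q hj M).mul_right _
  induction i using Nat.strong_induction_on with
  | _ i ih =>
    have h1 : ∑' M, x q n i ^ M * Z i M =
        1 + ∑ j ∈ Finset.range (i + 1), C (f i {j} Y) * (x q n j * ∑' M, x q n j ^ M * Z j M) := by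
      rw [(hs i hi).tsum_eq_zero_add, hZ, pow_zero, one_mul, tsum_congr (hrec i hi),
        Summable.tsum_finsetSum]
      · congr 1
        refine Finset.sum_congr rfl fun j hj => ?_
        rw [(hs j (by have := Finset.mem_range.1 hj; omega)).tsum_mul_left, mul_assoc]
      · intro j hj
        exact (hs j (by have := Finset.mem_range.1 hj; omega)).mul_left _
    rw [Finset.sum_range_succ, f_singleton_self hY, map_one, one_mul] at h1
    rw [sum_powerset_f_gp]
    have h2 : ∑ j ∈ Finset.range i, C (f i {j} Y) * (x q n j * ∑' M, x q n j ^ M * Z j M) =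
        ∑ j ∈ Finset.range i, C (f i {j} Y) * gp (x q n j) *
          ∑ J ∈ (Finset.range j).powerset, C (f j J Y) * ∏ l ∈ J, gp (x q n l) := by
      refine Finset.sum_congr rfl fun j hj => ?_
      have hj := Finset.mem_range.1 hj
      rw [ih j hj (hj.trans hi), mul_assoc]
    rw [h2] at h1
    have h3 := one_sub_x_mul_inv q hi
    rw [gp]
    generalize ∑' M, x q n i ^ M * Z i M = S at h1 ⊢
    generalize (1 - x q n i)⁻¹ = u at h3 ⊢
    linear_combination x q n i * u * h1 - x q n i * S * h3

end Summation

/-! ### Discrete valuation rings -/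

section Levels

variable {𝔬 : Type*} [CommRing 𝔬]

theorem finite_level [IsLocalRing 𝔬] [TopologicalSpace 𝔬] [CompactSpace 𝔬]
    (hadic : IsAdic (IsLocalRing.maximalIdeal 𝔬)) (N : ℕ) : Finite (Level 𝔬 N) := by
  have htop : IsTopologicalRing 𝔬 := by
    rw [IsAdic] at hadic
    subst hadic
    exact (IsLocalRing.maximalIdeal 𝔬).ringFilterBasis.isTopologicalRing
  exact AddSubgroup.quotient_finite_of_isOpen
    (IsLocalRing.maximalIdeal 𝔬 ^ N).toAddSubgroup ((isAdic_iff.1 hadic).1 N)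

variable [IsDomain 𝔬] [IsDiscreteValuationRing 𝔬]

theorem mul_mem_maximalIdeal_pow_succ_iff {ϖ : 𝔬} (hϖ : Irreducible ϖ) (M : ℕ) (a : 𝔬) :
    ϖ * a ∈ IsLocalRing.maximalIdeal 𝔬 ^ (M + 1) ↔ a ∈ IsLocalRing.maximalIdeal 𝔬 ^ M := by
  rw [hϖ.maximalIdeal_eq, Ideal.span_singleton_pow, Ideal.span_singleton_pow,
    Ideal.mem_span_singleton, Ideal.mem_span_singleton, pow_succ',
    mul_dvd_mul_iff_left hϖ.ne_zero]

/-- Multiplication by a uniformizer, as an embedding `𝔬_M → 𝔬_{M+1}`. -/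
def uniformizerMul {ϖ : 𝔬} (hϖ : Irreducible ϖ) (M : ℕ) : Level 𝔬 M →+ Level 𝔬 (M + 1) :=
  QuotientAddGroup.map _ _ (AddMonoidHom.mulLeft ϖ)
    fun a ha => (mul_mem_maximalIdeal_pow_succ_iff hϖ M a).2 ha

theorem uniformizerMul_mk {ϖ : 𝔬} (hϖ : Irreducible ϖ) (M : ℕ) (a : 𝔬) :
    uniformizerMul hϖ M (Ideal.Quotient.mk _ a) = Ideal.Quotient.mk _ (ϖ * a) := rfl

/-- The levels `𝔬_{M+1} → 𝔬_M` of a discrete valuation ring as a small extension over the residue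
field. -/
def levelExtension {ϖ : 𝔬} (hϖ : Irreducible ϖ) (M : ℕ) :
    SmallExtension (Level 𝔬 (M + 1)) (Level 𝔬 M) (IsLocalRing.ResidueField 𝔬) where
  red := Ideal.Quotient.lift _ (IsLocalRing.residue 𝔬) fun a ha =>
    (IsLocalRing.residue_eq_zero_iff a).2 (Ideal.pow_le_self M.succ_ne_zero ha)
  down := Ideal.Quotient.factorPow _ M.le_succ
  emb := uniformizerMul hϖ M
  red_surjective := Ideal.Quotient.lift_surjective_of_surjective _ _ IsLocalRing.residue_surjective
  down_surjective := Ideal.Quotient.factor_surjective _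
  emb_injective := by
    rw [injective_iff_map_eq_zero]
    intro s hs
    obtain ⟨a, rfl⟩ := Ideal.Quotient.mk_surjective s
    rw [uniformizerMul_mk, Ideal.Quotient.eq_zero_iff_mem,
      mul_mem_maximalIdeal_pow_succ_iff hϖ] at hs
    exact Ideal.Quotient.eq_zero_iff_mem.2 hs
  emb_down_mul := by
    intro r s
    obtain ⟨a, rfl⟩ := Ideal.Quotient.mk_surjective r
    obtain ⟨c, rfl⟩ := Ideal.Quotient.mk_surjective s
    rw [Ideal.Quotient.factor_mk, ← map_mul, uniformizerMul_mk, uniformizerMul_mk, ← map_mul,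
      mul_left_comm]
  red_eq_zero_iff := by
    intro r
    obtain ⟨a, rfl⟩ := Ideal.Quotient.mk_surjective r
    have hmem : ∀ c : 𝔬, c ∈ IsLocalRing.maximalIdeal 𝔬 ↔ ϖ ∣ c := fun c => by
      rw [hϖ.maximalIdeal_eq, Ideal.mem_span_singleton]
    rw [Ideal.Quotient.lift_mk, IsLocalRing.residue_eq_zero_iff, hmem]
    constructor
    · rintro ⟨c, rfl⟩
      exact ⟨Ideal.Quotient.mk _ c, uniformizerMul_mk hϖ M c⟩
    · rintro ⟨s, hs⟩
      obtain ⟨c, rfl⟩ := Ideal.Quotient.mk_surjective s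
      rw [uniformizerMul_mk, Ideal.Quotient.mk_eq_mk_iff_sub_mem] at hs
      have h := (hmem _).1 (Ideal.pow_le_self M.succ_ne_zero hs)
      exact (dvd_sub_right (dvd_mul_right ϖ c)).1 h

theorem card_level (N : ℕ) : Nat.card (Level 𝔬 N) = residueCard 𝔬 ^ N := by
  have h := cardQuot_pow_of_prime (P := IsLocalRing.maximalIdeal 𝔬)
    (IsDiscreteValuationRing.not_a_field 𝔬) (i := N)
  rwa [Submodule.cardQuot_apply, Submodule.cardQuot_apply] at h

instance isLocalRing_level (M : ℕ) : IsLocalRing (Level 𝔬 (M + 1)) := by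
  obtain ⟨ϖ, hϖ⟩ := IsDiscreteValuationRing.exists_irreducible 𝔬
  have : Nontrivial (Level 𝔬 (M + 1)) :=
    Ideal.Quotient.nontrivial_iff.2 fun h => Ideal.IsPrime.ne_top'
      (I := IsLocalRing.maximalIdeal 𝔬) (top_le_iff.1 (h ▸ Ideal.pow_le_self M.succ_ne_zero))
  exact IsLocalRing.of_surjective' (Ideal.Quotient.mk _) Ideal.Quotient.mk_surjective

/-- A traceless matrix is primitive precisely when its reduction is nonzero. This uses that
`𝔭 sl_n(𝔬_N)` consists of all traceless matrices with entries in `𝔭`. -/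
theorem mem_primitive_succ_iff {ϖ : 𝔬} (hϖ : Irreducible ϖ) {n M : ℕ}
    (A : Matrix (Fin n) (Fin n) (Level 𝔬 (M + 1))) :
    A ∈ primitive 𝔬 n (M + 1) ↔ A.map (levelExtension hϖ M).red ≠ 0 ∧ A.trace = 0 := by
  set E := levelExtension hϖ M
  have hsl : ∀ B : Matrix (Fin n) (Fin n) (Level 𝔬 (M + 1)),
      B ∈ sl 𝔬 n (M + 1) ↔ B.trace = 0 := fun B => by
    rw [sl, LinearMap.mem_ker, Matrix.traceLinearMap_apply]
  suffices h : A.trace = 0 → (A ∈ IsLocalRing.maximalIdeal 𝔬 • sl 𝔬 n (M + 1) ↔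
      A.map E.red = 0) by
    change (A ∈ sl 𝔬 n (M + 1) ∧ A ∉ IsLocalRing.maximalIdeal 𝔬 • sl 𝔬 n (M + 1)) ↔ _
    rw [hsl]
    constructor
    · rintro ⟨h1, h2⟩; exact ⟨mt (h h1).2 h2, h1⟩
    · rintro ⟨h1, h2⟩; exact ⟨h2, mt (h h2).1 h1⟩
  intro htr
  constructor
  · intro hA
    refine Submodule.smul_induction_on hA ?_ ?_
    · intro r hr B _
      have hr' : E.red (Ideal.Quotient.mk _ r) = 0 := (IsLocalRing.residue_eq_zero_iff r).2 hr
      ext i j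
      have : (r • B) i j = Ideal.Quotient.mk _ r * B i j := by
        rw [Matrix.smul_apply, Algebra.smul_def]; rfl
      rw [Matrix.map_apply, this, map_mul, hr', zero_mul, Matrix.zero_apply]
    · intro B B' hB hB'
      rw [Matrix.map_add _ (map_add E.red), hB, hB', add_zero]
  · intro hA
    obtain ⟨s, rfl⟩ := (E.map_red_eq_zero_iff A).1 hA
    choose g hg using E.down_surjective
    rcases n with _ | n
    · rw [Subsingleton.elim (s.map E.emb) 0]; exact Submodule.zero_mem _
    have hmul : ∀ r, (Ideal.Quotient.mk _ ϖ : Level 𝔬 (M + 1)) * r = E.emb (E.down r) := by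
      intro r
      obtain ⟨a, rfl⟩ := Ideal.Quotient.mk_surjective r
      rfl
    -- a lift of `s`, corrected in one diagonal entry so as to have trace zero
    set B := s.map g - Matrix.single 0 0 (s.map g).trace with hB
    have hBtr : B.trace = 0 := by
      rw [hB, Matrix.trace_sub, Matrix.trace_single_eq_same, sub_self]
    have hcorr : E.emb (E.down (s.map g).trace) = 0 := by
      have h1 : E.down (s.map g).trace = s.trace := by
        simp [Matrix.trace, map_sum, hg]
      have h2 : E.emb s.trace = (s.map E.emb).trace := by
        simp [Matrix.trace, map_sum]
      rw [h1, h2, htr]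
    have hsB : s.map E.emb = ϖ • B := by
      ext i j
      rw [Matrix.smul_apply, Algebra.smul_def]
      change E.emb (s i j) = Ideal.Quotient.mk _ ϖ * _
      rw [hmul, hB, Matrix.sub_apply, map_sub, map_sub, Matrix.map_apply, hg, Matrix.single_apply]
      split_ifs
      · rw [hcorr, sub_zero]
      · simp
    rw [hsB]
    exact Submodule.smul_mem_smul (hϖ.maximalIdeal_eq ▸ Ideal.mem_span_singleton_self ϖ)
      ((hsl B).2 hBtr)

end Levels

/-! ### The image zeta function -/

section Zeta

namespace SmallExtension

variable {R S k : Type*} [CommRing R] [CommRing S] [Field k] (E : SmallExtension R S k)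

/-- The possible sizes of images of the lifts of a matrix of rank `n - i` are those coming from
`i × i`-matrices over the lower level. -/
theorem rangeCard_lift [Finite R] [Finite S] [IsLocalRing R] {P : ℕ → Prop} {n i : ℕ} (hi : i ≤ n)
    {A : Matrix (Fin n) (Fin n) R} (hA : (A.map E.red).rank = n - i)
    (hP : ∀ d : Matrix (Fin i) (Fin i) S, P (Nat.card R ^ (n - i) * rangeCard d)) :
    P (rangeCard A) := by
  classical
  cases nonempty_fintype R
  cases nonempty_fintype S
  -- weigh each lift by whether `P` fails: a sum of zeros on the lower level
  have h := E.sum_lifts_rangeCard (fun m => if P m then (0 : ℕ) else 1) hi hA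
  simp only [hP, if_true, Finset.sum_const_zero, mul_zero] at h
  by_contra hPA
  have h2 := Finset.sum_eq_zero_iff.1 h A (by simp)
  rw [if_neg hPA] at h2
  exact one_ne_zero h2

end SmallExtension

/-- The summand `t^k` attached to an image of size `m = q^k`. -/
def weight (q m : ℕ) : ℚ⟦X⟧ := X ^ Nat.log q m

theorem weight_pow_mul {q : ℕ} (hq : 1 < q) (a : ℕ) {m : ℕ} (hm : 0 < m) :
    weight q (q ^ a * m) = X ^ a * weight q m := by
  have h : Nat.log q (q ^ a * m) = a + Nat.log q m := by
    induction a with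
    | zero => simp
    | succ a ih =>
      rw [pow_succ', mul_assoc, mul_comm q, Nat.log_mul_base hq (by positivity), ih]
      ring
  rw [weight, h, pow_add, weight]

variable (𝔬 : Type*) [CommRing 𝔬] [IsDomain 𝔬] [IsDiscreteValuationRing 𝔬]

theorem one_lt_residueCard [Finite (IsLocalRing.ResidueField 𝔬)] : 1 < residueCard 𝔬 :=
  Finite.one_lt_card

omit [IsDomain 𝔬] [IsDiscreteValuationRing 𝔬] in
theorem subsingleton_level_zero [IsLocalRing 𝔬] : Subsingleton (Level 𝔬 0) := by
  rw [Level, pow_zero, Ideal.one_eq_top]; infer_instance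

/-- The size of every image is a power of `q`. -/
theorem exists_rangeCard_eq_pow [∀ N, Finite (Level 𝔬 N)] (N n : ℕ)
    (A : Matrix (Fin n) (Fin n) (Level 𝔬 N)) : ∃ k, rangeCard A = residueCard 𝔬 ^ k := by
  obtain ⟨ϖ, hϖ⟩ := IsDiscreteValuationRing.exists_irreducible 𝔬
  induction N generalizing n with
  | zero =>
    have := subsingleton_level_zero 𝔬
    exact ⟨0, (rangeCard_of_subsingleton A).trans (pow_zero _).symm⟩
  | succ M ih =>
    have hr := Matrix.rank_le_width (A.map (levelExtension hϖ M).red)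
    refine (levelExtension hϖ M).rangeCard_lift (P := fun m => ∃ k, m = residueCard 𝔬 ^ k)
      (Nat.sub_le n _) (Nat.sub_sub_self hr).symm fun d => ?_
    obtain ⟨k, hk⟩ := ih _ d
    exact ⟨_, by rw [hk, card_level, ← pow_mul, ← pow_add]⟩

/-- The image of a primitive matrix of level `N` has at least `q^N` elements. -/
theorem le_log_rangeCard [∀ N, Finite (Level 𝔬 N)] [Finite (IsLocalRing.ResidueField 𝔬)]
    {n N : ℕ} {A : Matrix (Fin n) (Fin n) (Level 𝔬 N)} (hA : A ∈ primitive 𝔬 n N) :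
    N ≤ Nat.log (residueCard 𝔬) (rangeCard A) := by
  obtain ⟨ϖ, hϖ⟩ := IsDiscreteValuationRing.exists_irreducible 𝔬
  rcases N with _ | M
  · exact Nat.zero_le _
  have hr := Matrix.rank_le_width (A.map (levelExtension hϖ M).red)
  have hr0 : 1 ≤ (A.map (levelExtension hϖ M).red).rank := by
    rw [Nat.one_le_iff_ne_zero, Ne, rank_eq_zero_iff]
    exact ((mem_primitive_succ_iff hϖ A).1 hA).1
  refine Nat.le_log_of_pow_le (one_lt_residueCard 𝔬) ?_
  refine (levelExtension hϖ M).rangeCard_lift (P := fun m => residueCard 𝔬 ^ (M + 1) ≤ m)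
    (Nat.sub_le n _) (Nat.sub_sub_self hr).symm fun d => ?_
  rw [card_level, Nat.sub_sub_self hr]
  exact (Nat.le_self_pow (by omega) _).trans (Nat.le_mul_of_pos_right _ (rangeCard_pos d))

theorem one_sub_inv_residueCard_pow_ne_zero [Finite (IsLocalRing.ResidueField 𝔬)] (j : ℕ) :
    1 - ((residueCard 𝔬 : ℚ)⁻¹) ^ (j + 1) ≠ 0 := by
  have hq : (1 : ℚ) < residueCard 𝔬 := by exact_mod_cast one_lt_residueCard 𝔬
  exact (sub_pos.2 (pow_lt_one₀ (by positivity) (inv_lt_one_of_one_lt₀ hq) j.succ_ne_zero)).ne'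

theorem residueCard_mul_inv [Finite (IsLocalRing.ResidueField 𝔬)] : (residueCard 𝔬 : ℚ) * (residueCard 𝔬 : ℚ)⁻¹ = 1 :=
  mul_inv_cancel₀ (by have := one_lt_residueCard 𝔬; positivity)

variable [∀ N, Fintype (Level 𝔬 N)]

/-- The sum of `|im A|^(-s)` over all `i × i`-matrices `A` of level `M`. -/
def levelZeta (i M : ℕ) : ℚ⟦X⟧ :=
  ∑ A : Matrix (Fin i) (Fin i) (Level 𝔬 M), weight (residueCard 𝔬) (rangeCard A)

open scoped Classical in
/-- The sum of `|im A|^(-s)` over the primitive traceless matrices `A` of level `N`. -/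
def primitiveZeta (n N : ℕ) : ℚ⟦X⟧ :=
  ∑ A with A ∈ primitive 𝔬 n N, weight (residueCard 𝔬) (rangeCard A)

open scoped Classical in
theorem pairs_eq_coe_finset (n k : ℕ) [Finite (IsLocalRing.ResidueField 𝔬)] :
    pairs 𝔬 n k = ↑((Finset.range (k + 1)).sigma fun N =>
      Finset.univ.filter fun A : Matrix (Fin n) (Fin n) (Level 𝔬 N) =>
        A ∈ primitive 𝔬 n N ∧ k = Nat.log (residueCard 𝔬) (rangeCard A)) := by
  have hq := one_lt_residueCard 𝔬
  ext ⟨N, A⟩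
  simp only [pairs, Set.mem_ofPred_eq, Finset.coe_sigma, Set.mem_sigma_iff, Finset.mem_coe,
    Finset.mem_range, Finset.mem_filter, Finset.mem_univ, true_and]
  change (_ ∧ rangeCard A = _) ↔ _
  obtain ⟨l, hl⟩ := exists_rangeCard_eq_pow 𝔬 N n A
  constructor
  · rintro ⟨h1, h2⟩
    have h3 := le_log_rangeCard 𝔬 h1
    rw [h2, Nat.log_pow hq] at h3
    exact ⟨by omega, h1, by rw [h2, Nat.log_pow hq]⟩
  · rintro ⟨-, h1, h2⟩
    refine ⟨h1, ?_⟩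
    rw [hl, Nat.log_pow hq] at h2
    rw [hl, h2]

open scoped PowerSeries.WithPiTopology in
theorem hasSum_primitiveZeta (n : ℕ) [Finite (IsLocalRing.ResidueField 𝔬)] :
    HasSum (primitiveZeta 𝔬 n) (imageZeta 𝔬 n) := by
  classical
  rw [PowerSeries.WithPiTopology.hasSum_iff_hasSum_coeff]
  intro k
  have hcoeff : ∀ N, coeff k (primitiveZeta 𝔬 n N) =
      ((Finset.univ.filter fun A : Matrix (Fin n) (Fin n) (Level 𝔬 N) =>
        A ∈ primitive 𝔬 n N ∧ k = Nat.log (residueCard 𝔬) (rangeCard A)).card : ℚ) := by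
    intro N
    simp only [primitiveZeta, map_sum, weight, coeff_X_pow]
    rw [Finset.sum_boole, Finset.filter_filter]
  have hk : coeff k (imageZeta 𝔬 n) =
      ∑ N ∈ Finset.range (k + 1), coeff k (primitiveZeta 𝔬 n N) := by
    rw [imageZeta, coeff_mk, pairs_eq_coe_finset, Set.ncard_coe_finset, Finset.card_sigma,
      Nat.cast_sum]
    exact Finset.sum_congr rfl fun N _ => (hcoeff N).symm
  rw [hk]
  refine hasSum_sum_of_ne_finset_zero fun N hN => ?_
  rw [hcoeff, Nat.cast_eq_zero, Finset.card_eq_zero, Finset.filter_eq_empty_iff]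
  rintro A - ⟨hA, hA'⟩
  have := le_log_rangeCard 𝔬 hA
  rw [Finset.mem_range] at hN
  omega

theorem levelZeta_zero (i : ℕ) : levelZeta 𝔬 i 0 = 1 := by
  have := subsingleton_level_zero 𝔬
  have : Unique (Matrix (Fin i) (Fin i) (Level 𝔬 0)) :=
    ⟨⟨0⟩, fun A => by ext; exact Subsingleton.elim _ _⟩
  rw [levelZeta, Fintype.sum_unique, weight, rangeCard_of_subsingleton, Nat.log_one_right,
    pow_zero]

theorem primitiveZeta_zero (n : ℕ) : primitiveZeta 𝔬 n 0 = 1 := by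
  have := subsingleton_level_zero 𝔬
  have h : ∀ A : Matrix (Fin n) (Fin n) (Level 𝔬 0), A ∈ primitive 𝔬 n 0 :=
    fun A => by ext; exact Subsingleton.elim _ _
  rw [← levelZeta_zero 𝔬 n, primitiveZeta, levelZeta]
  simp [h]

open scoped Classical in
/-- Sorting matrices over a finite field by the corank. -/
theorem sum_eq_sum_corank {F : Type*} [Field F] [Fintype F] {M : Type*} [AddCommMonoid M] {n : ℕ}
    (s : Finset (Matrix (Fin n) (Fin n) F)) (G : Matrix (Fin n) (Fin n) F → M) :
    ∑ A ∈ s, G A = ∑ i ∈ Finset.range (n + 1), ∑ A ∈ s with A.rank = n - i, G A := by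
  rw [← Finset.sum_fiberwise_of_maps_to (t := Finset.range (n + 1)) (g := fun A => n - A.rank)
    (fun A _ => Finset.mem_range.2 (by omega))]
  refine Finset.sum_congr rfl fun i hi => Finset.sum_congr ?_ fun _ _ => rfl
  ext A
  have := A.rank_le_width
  have := Finset.mem_range.1 hi
  simp only [Finset.mem_filter]
  refine and_congr_right fun _ => ?_
  omega

variable [Fintype (IsLocalRing.ResidueField 𝔬)]

open scoped Classical in
/-- The contribution of the lifts of a matrix of rank `n - i`. -/
theorem sum_lifts_weight {ϖ : 𝔬} (hϖ : Irreducible ϖ) {n i : ℕ} (hi : i ≤ n) (M : ℕ)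
    {A : Matrix (Fin n) (Fin n) (IsLocalRing.ResidueField 𝔬)} (hA : A.rank = n - i) :
    ∑ A' with A'.map (levelExtension hϖ M).red = A, weight (residueCard 𝔬) (rangeCard A') =
      C (((residueCard 𝔬 : ℚ) ^ M) ^ (n ^ 2 - i ^ 2)) * X ^ ((M + 1) * (n - i)) *
        levelZeta 𝔬 i M := by
  rw [(levelExtension hϖ M).sum_lifts_rangeCard _ hi hA]
  simp only [card_level, ← pow_mul (residueCard 𝔬),
    weight_pow_mul (one_lt_residueCard 𝔬) _ (rangeCard_pos _)]
  rw [← Finset.mul_sum, levelZeta]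
  simp only [map_pow, map_natCast, Nat.cast_pow, mul_assoc, pow_mul]

/-- The recursion between the zeta functions of all `i × i`-matrices, obtained by grouping the
matrices of level `M + 1` by their reductions. The factor `x_{n,i}^(M+1)` absorbs all the powers
of `q` and `t`. -/
theorem x_pow_mul_levelZeta_succ {n i : ℕ} (hi : i < n) (M : ℕ) :
    x (residueCard 𝔬) n i ^ (M + 1) * levelZeta 𝔬 i (M + 1) =
      ∑ j ∈ Finset.range (i + 1), C (f i {j} (residueCard 𝔬 : ℚ)⁻¹) * x (residueCard 𝔬) n j *
        (x (residueCard 𝔬) n j ^ M * levelZeta 𝔬 j M) := by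
  classical
  obtain ⟨ϖ, hϖ⟩ := IsDiscreteValuationRing.exists_irreducible 𝔬
  have hX := one_sub_inv_residueCard_pow_ne_zero 𝔬
  have hqX := residueCard_mul_inv 𝔬
  rw [levelZeta, ← Finset.sum_fiberwise _ fun A => A.map (levelExtension hϖ M).red,
    sum_eq_sum_corank, Finset.mul_sum]
  refine Finset.sum_congr rfl fun j hj => ?_
  have hj : j ≤ i := Nat.lt_succ_iff.1 (Finset.mem_range.1 hj)
  rw [Finset.sum_congr rfl fun A hA => sum_lifts_weight 𝔬 hϖ hj M (Finset.mem_filter.1 hA).2,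
    Finset.sum_const, nsmul_eq_mul]
  have hcard := card_rank_eq (F := IsLocalRing.ResidueField 𝔬) i (i - j)
  rw [← Nat.card_eq_fintype_card] at hcard
  change _ = (gaussBinom (residueCard 𝔬) i (i - j) : ℚ) *
    ∏ l ∈ Finset.range (i - j), ((residueCard 𝔬 : ℚ) ^ i - (residueCard 𝔬 : ℚ) ^ l) at hcard
  rw [pow_sq_sub_sq_mul_f hX hqX hj] at hcard
  rw [← map_natCast (C (R := ℚ)), hcard]
  have hx : x (residueCard 𝔬) n j =
      x (residueCard 𝔬) n i * (C ((residueCard 𝔬 : ℚ) ^ (i ^ 2 - j ^ 2)) * X ^ (i - j)) := by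
    have h1 : n ^ 2 - j ^ 2 - 1 = (n ^ 2 - i ^ 2 - 1) + (i ^ 2 - j ^ 2) := by
      have := Nat.pow_lt_pow_left hi two_ne_zero
      have := Nat.pow_le_pow_left hj 2
      omega
    have h2 : n - j = (n - i) + (i - j) := by omega
    rw [x, x, h1, h2, pow_add, pow_add, map_mul]
    ring
  rw [hx]
  simp only [map_mul, map_pow]
  ring

/-- Primitive traceless matrices of level `N + 1` in terms of all matrices of level `N`: the
coefficient `b_{n,i}(q⁻¹) q^(n² - i² - 1)` is the number of traceless matrices of rank `n - i` over
the residue field. -/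
theorem primitiveZeta_succ {n : ℕ} (N : ℕ) :
    primitiveZeta 𝔬 n (N + 1) =
      ∑ i ∈ Finset.range n, C (b n i (residueCard 𝔬 : ℚ)⁻¹) * x (residueCard 𝔬) n i *
        (x (residueCard 𝔬) n i ^ N * levelZeta 𝔬 i N) := by
  classical
  obtain ⟨ϖ, hϖ⟩ := IsDiscreteValuationRing.exists_irreducible 𝔬
  have hX := one_sub_inv_residueCard_pow_ne_zero 𝔬
  have hqX := residueCard_mul_inv 𝔬
  have hq0 : (residueCard 𝔬 : ℚ) ≠ 0 := left_ne_zero_of_mul_eq_one hqX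
  set E := levelExtension hϖ N with hE
  -- group the primitive matrices by their reductions
  have hfib : primitiveZeta 𝔬 n (N + 1) =
      ∑ A : Matrix (Fin n) (Fin n) (IsLocalRing.ResidueField 𝔬) with A ≠ 0 ∧ A.trace = 0,
        ∑ A' with A'.map E.red = A ∧ A'.trace = 0, weight (residueCard 𝔬) (rangeCard A') := by
    rw [primitiveZeta, ← Finset.sum_fiberwise_of_maps_to (g := fun A => A.map E.red)
      (t := Finset.univ.filter fun A => A ≠ 0 ∧ A.trace = 0)]
    · refine Finset.sum_congr rfl fun A hA => Finset.sum_congr ?_ fun _ _ => rfl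
      ext A'
      simp only [Finset.mem_filter, Finset.mem_univ, true_and, mem_primitive_succ_iff hϖ, ← hE]
      have := (Finset.mem_filter.1 hA).2.1
      constructor
      · rintro ⟨⟨-, h1⟩, h2⟩; exact ⟨h2, h1⟩
      · rintro ⟨rfl, h2⟩; exact ⟨⟨this, h2⟩, rfl⟩
    · intro A hA
      have h := (mem_primitive_succ_iff hϖ A).1 (Finset.mem_filter.1 hA).2
      refine Finset.mem_filter.2 ⟨Finset.mem_univ _, h.1, ?_⟩
      have ht : E.red A.trace = (A.map E.red).trace :=
        AddMonoidHom.map_trace E.red.toAddMonoidHom A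
      rw [← ht, h.2, map_zero]
  have hC : (C ((residueCard 𝔬 : ℚ) ^ N) : ℚ⟦X⟧) ≠ 0 := by
    rw [Ne, map_eq_zero_iff _ (C_injective (R := ℚ))]
    exact pow_ne_zero _ hq0
  refine mul_left_cancel₀ hC ?_
  rw [hfib, Finset.mul_sum]
  have hstep : ∀ A ∈ Finset.univ.filter (fun A : Matrix (Fin n) (Fin n)
      (IsLocalRing.ResidueField 𝔬) => A ≠ 0 ∧ A.trace = 0),
      C ((residueCard 𝔬 : ℚ) ^ N) *
        ∑ A' with A'.map E.red = A ∧ A'.trace = 0, weight (residueCard 𝔬) (rangeCard A') =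
      ∑ A' with A'.map E.red = A, weight (residueCard 𝔬) (rangeCard A') := by
    intro A hA
    have hA := (Finset.mem_filter.1 hA).2
    rw [← E.card_mul_sum_traceless_lifts _ hA.1 hA.2, card_level]
    simp only [map_pow, map_natCast, Nat.cast_pow]
  rw [Finset.sum_congr rfl hstep, sum_eq_sum_corank, Finset.sum_range_succ]
  -- corank `n` means the zero matrix
  have hzero : ∑ A ∈ Finset.univ.filter (fun A : Matrix (Fin n) (Fin n)
      (IsLocalRing.ResidueField 𝔬) => A ≠ 0 ∧ A.trace = 0) with A.rank = n - n,
      ∑ A' with A'.map E.red = A, weight (residueCard 𝔬) (rangeCard A') = 0 := by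
    rw [Finset.filter_eq_empty_iff.2, Finset.sum_empty]
    intro A hA h
    rw [Nat.sub_self, rank_eq_zero_iff] at h
    exact (Finset.mem_filter.1 hA).2.1 h
  rw [hzero, add_zero, Finset.mul_sum]
  refine Finset.sum_congr rfl fun i hi => ?_
  have hi := Finset.mem_range.1 hi
  rw [Finset.sum_congr rfl fun A hA => sum_lifts_weight 𝔬 hϖ hi.le N (Finset.mem_filter.1 hA).2,
    Finset.sum_const, nsmul_eq_mul]
  have hset : ((Finset.univ.filter (fun A : Matrix (Fin n) (Fin n)
      (IsLocalRing.ResidueField 𝔬) => A ≠ 0 ∧ A.trace = 0)).filter fun A => A.rank = n - i) =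
      Finset.univ.filter fun A => A.rank = n - i ∧ A.trace = 0 := by
    ext A
    simp only [Finset.mem_filter, Finset.mem_univ, true_and]
    constructor
    · rintro ⟨⟨-, h1⟩, h2⟩; exact ⟨h2, h1⟩
    · rintro ⟨h2, h1⟩
      refine ⟨⟨?_, h1⟩, h2⟩
      rintro rfl
      rw [Matrix.rank_zero] at h2
      omega
  have hcard := card_rank_eq_trace_zero (F := IsLocalRing.ResidueField 𝔬) n (n - i)
  rw [← Nat.card_eq_fintype_card] at hcard
  change (residueCard 𝔬 : ℚ) * _ = (gaussBinom (residueCard 𝔬) n (n - i) : ℚ) *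
    (∏ l ∈ Finset.range (n - i), ((residueCard 𝔬 : ℚ) ^ n - (residueCard 𝔬 : ℚ) ^ l) +
      ((residueCard 𝔬 : ℚ) - 1) * ((-1) ^ (n - i) * (residueCard 𝔬 : ℚ) ^ (n - i).choose 2))
    at hcard
  have he : n ^ 2 - i ^ 2 = (n ^ 2 - i ^ 2 - 1) + 1 := by
    have := Nat.pow_lt_pow_left hi two_ne_zero
    omega
  rw [pow_sq_sub_sq_mul_b hX hqX hi, he, pow_succ', mul_assoc] at hcard
  have hcard := mul_left_cancel₀ hq0 hcard
  rw [hset, ← map_natCast (C (R := ℚ)), hcard, he, Nat.add_sub_cancel, x]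
  simp only [map_mul, map_pow]
  ring

open scoped PowerSeries.WithPiTopology in
theorem imageZeta_eq (n : ℕ) :
    imageZeta 𝔬 n = 1 + ∑ i ∈ Finset.range n,
      C (b n i (residueCard 𝔬 : ℚ)⁻¹) * gp (x (residueCard 𝔬) n i) *
        ∑ J ∈ (Finset.range i).powerset, C (f i J (residueCard 𝔬 : ℚ)⁻¹) *
          ∏ j ∈ J, gp (x (residueCard 𝔬) n j) := by
  have hsum := hasSum_primitiveZeta 𝔬 n
  rw [← hsum.tsum_eq, hsum.summable.tsum_eq_zero_add, primitiveZeta_zero,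
    tsum_congr (primitiveZeta_succ 𝔬)]
  have hs : ∀ i ∈ Finset.range n, Summable fun N => x (residueCard 𝔬) n i ^ N *
      levelZeta 𝔬 i N := fun i hi => summable_of_X_pow_dvd fun N =>
    (X_pow_dvd_x_pow _ (Finset.mem_range.1 hi) N).mul_right _
  rw [Summable.tsum_finsetSum fun i hi => (hs i hi).mul_left _]
  congr 1
  refine Finset.sum_congr rfl fun i hi => ?_
  rw [(hs i hi).tsum_mul_left, mul_assoc, mul_assoc,
    tsum_x_pow_mul (one_sub_inv_residueCard_pow_ne_zero 𝔬)
      (levelZeta_zero 𝔬) (fun i hi M => x_pow_mul_levelZeta_succ 𝔬 hi M)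
      (Finset.mem_range.1 hi)]

end Zeta

end ImageZeta

end

/-- The first two conjuncts say that the image zeta function is well defined: every summand
`|im A|^(-s)` is a power of `t = q^(-s)`, and each power occurs finitely often. -/
theorem mainTheorem7 (𝔬 : Type*) [CommRing 𝔬] [IsDomain 𝔬] [IsDiscreteValuationRing 𝔬]
    [TopologicalSpace 𝔬] [CompactSpace 𝔬] (hadic : IsAdic (IsLocalRing.maximalIdeal 𝔬))
    (n : ℕ) (hn : 1 ≤ n) :
    (∀ (N : ℕ), ∀ A ∈ ImageZeta.primitive 𝔬 n N,
      ∃ k : ℕ, ImageZeta.imageCard A = ImageZeta.residueCard 𝔬 ^ k) ∧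
    (∀ k : ℕ, (ImageZeta.pairs 𝔬 n k).Finite) ∧
    ImageZeta.imageZeta 𝔬 n =
      1 + ∑ i ∈ Finset.range n,
        PowerSeries.C (ImageZeta.b n i ((ImageZeta.residueCard 𝔬 : ℚ)⁻¹)) *
          ImageZeta.gp (ImageZeta.x (ImageZeta.residueCard 𝔬) n i) *
          ∑ J ∈ (Finset.range i).powerset,
            PowerSeries.C (ImageZeta.f i J ((ImageZeta.residueCard 𝔬 : ℚ)⁻¹)) *
              ∏ j ∈ J, ImageZeta.gp (ImageZeta.x (ImageZeta.residueCard 𝔬) n j) := by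
  have hfin := ImageZeta.finite_level hadic
  have hfin1 : Finite (IsLocalRing.ResidueField 𝔬) := by
    obtain ⟨ϖ, hϖ⟩ := IsDiscreteValuationRing.exists_irreducible 𝔬
    exact Finite.of_surjective _ (ImageZeta.levelExtension hϖ 0).red_surjective
  have : ∀ N, Fintype (ImageZeta.Level 𝔬 N) := fun N => Fintype.ofFinite _
  have : Fintype (IsLocalRing.ResidueField 𝔬) := Fintype.ofFinite _
  refine ⟨fun N A _ => ImageZeta.exists_rangeCard_eq_pow 𝔬 N n A, fun k => ?_,
    ImageZeta.imageZeta_eq 𝔬 n⟩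
  rw [ImageZeta.pairs_eq_coe_finset]
  exact Finset.finite_toSet _
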